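/- **Proposition 3.3 (step initial condition, finite time kernel).** *Setting.* Let $a,b:\mathbb R\to\mathbb R$ with $a(t),b(t)$ the integrated right and left jump intensities. For pairs (particle label, time) write $(n_1,t_1)\prec(n_2,t_2)$ if $n_1\le n_2$, $t_2\le t_1$ and the two pairs are not identical; a finite sequence $p_1,\dots,p_m$ of such pairs is a space-like path if $p_i\prec p_j$ for $i<j$. For rates $v_1,v_2,\dots>0$ and initial positions $y_1>y_2>\cdots$ the PushASEP kernel is $$K((n_1,t_1),x_1;(n_2,t_2),x_2)=-\phi^{((n_1,t_1),(n_2,t_2))}(x_1,x_2)+\sum_{k=1}^{n_2}\Psi^{n_1,t_1}_{n_1-k}(x_1)\,\Phi^{n_2,t_2}_{n_2-k}(x_2),$$ where $$\Psi^{n,t}_{n-l}(x)=\frac1{2\pi i}\oint_{\Gamma_0}dz\,z^{x-y_l-1}e^{a(t)/z+b(t)z}\,\frac{(1-v_1z)\cdots(1-v_nz)}{(1-v_1z)\cdots(1-v_lz)},\qquad l\ge 1,$$ $$\phi^{((n_1,t_1),(n_2,t_2))}(x_1,x_2)=\frac1{2\pi i}\oint_{\Gamma_0}\frac{dz}{z^{x_2-x_1+1}}\,\frac{e^{(a(t_1)-a(t_2))/z}e^{(b(t_1)-b(t_2))z}}{(1-v_{n_1+1}z)\cdots(1-v_{n_2}z)}\,\mathbb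 1_{[(n_1,t_1)\prec(n_2,t_2)]},$$ and $\{\Phi^{n,t}_{n-k}\}_{k=1}^n$ are the functions $\mathbb Z\to\mathbb C$ with $\sum_{x\in\mathbb Z}\Psi^{n,t}_{n-l}(x)\Phi^{n,t}_{n-k}(x)=\delta_{k,l}$ for $1\le k,l\le n$, whose span is $V_n=\mathrm{span}\{x^lu^x\}$, with $u$ running over the distinct values of $v_1,\dots,v_n$ and $0\le l<$ multiplicity of $u$. Here $\Gamma_0$ is any closed contour going once anticlockwise around $0$ and not around any pole $1/v_j$. *Claim.* Let $v_k=1$ and $y_k=-k$ for all $k\ge1$. Then for all $n,t$ the family $\{\Phi^{n,t}_{n-k}\}_{k=1}^n$ exists and is unique. Moreover, for any two pairs $(n_1,t_1)$, $(n_2,t_2)$ on a common space-like path (so they are equal, or one of them precedes the other) and all $x_1,x_2\in\mathbb Z$, one has $(-1)^{n_1-n_2}K((n_1,t_1),x_1;(n_2,t_2),x_2)=K^{\rm step}((n_1,t_1),x_1;(n_2,t_2),x_2)$, where $$\begin{aligned}K^{\rm step}((n_1,t_1),x_1;(n_2,t_2),x_2)=&-\frac1{2\pi i}\oint_{\Gamma_0}dw\,\frac1{w^{x_1-x_2+1}}\Big(\frac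 w{1-w}\Big)^{n_2-n_1}\frac{e^{a(t_1)w+b(t_1)/w}}{e^{a(t_2)w+b(t_2)/w}}\,\mathbb 1_{[(n_1,t_1)\prec(n_2,t_2)]}\\&+\frac1{(2\pi i)^2}\oint_{\Gamma_0}dw\oint_{\Gamma_1}dz\,\frac{e^{b(t_1)/w+a(t_1)w}}{e^{b(t_2)/z+a(t_2)z}}\,\frac{(1-w)^{n_1}}{w^{x_1+n_1+1}}\,\frac{z^{x_2+n_2}}{(1-z)^{n_2}}\,\frac1{w-z}.\end{aligned}$$ In the single integral $\Gamma_0$ goes once anticlockwise around $0$ and not around $1$. In the double integral $\Gamma_0$ goes once anticlockwise around $0$ and not around $1$ or any point of $\Gamma_1$, and $\Gamma_1$ goes once anticlockwise around $1$ and not around $0$ or any point of $\Gamma_0$; in particular the two contours are disjoint. Consequently $K$ and $K^{\rm step}$ have the same correlation determinants: for all pairs $p_1,\dots,p_r$ on a common space-like path (repetitions allowed) and all $x_1,\dots,x_r\in\mathbb Z$, $$\det[K(p_\alpha,x_\alpha;p_\beta,x_\beta)]_{1\le\alpha,\beta\le r}=\det[K^{\rm step}(p_\alpha,x_\alpha;p_\beta,x_\beta)]_{1\le\alpha,\beta\le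 r}.$$ -/

import Mathlib

noncomputable section

namespace PushASEP

/-! ### Contours -/

/-- A closed contour in `ℂ`, parametrised by `[0, 1]`: continuous, closed, differentiable
except at finitely many corners, with integrable derivative.  In particular every closed
piecewise `C¹` curve is of this kind. -/
structure Loop where
  path : ℝ → ℂ
  continuousOn_path : ContinuousOn path (Set.Icc 0 1)
  closed : path 0 = path 1
  differentiable_off_corners :
    ∃ S : Finset ℝ, ∀ s ∈ Set.Ioo (0 : ℝ) 1, s ∉ S → DifferentiableAt ℝ path s
  integrable_deriv : IntervalIntegrable (deriv path) MeasureTheory.volume 0 1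

/-- The normalised contour integral `(2πi)⁻¹ ∮_γ f(z) dz`. -/
def Loop.integral (γ : Loop) (f : ℂ → ℂ) : ℂ :=
  (2 * Real.pi * Complex.I)⁻¹ * ∫ s in (0 : ℝ)..1, f (γ.path s) * deriv γ.path s

/-- `γ` avoids the point `p`. -/
def Loop.Avoids (γ : Loop) (p : ℂ) : Prop := ∀ s ∈ Set.Icc (0 : ℝ) 1, γ.path s ≠ p

/-- The winding number of `γ` around `p` (for `γ` avoiding `p`). -/
def Loop.winding (γ : Loop) (p : ℂ) : ℂ := γ.integral (fun z => (z - p)⁻¹)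

/-- `γ` goes around `p` once, anticlockwise.  For an anticlockwise simple loop: `p` lies
inside. -/
def Loop.Includes (γ : Loop) (p : ℂ) : Prop := γ.Avoids p ∧ γ.winding p = 1

/-- `γ` does not go around `p`.  For a simple loop: `p` lies outside. -/
def Loop.Excludes (γ : Loop) (p : ℂ) : Prop := γ.Avoids p ∧ γ.winding p = 0

/-! ### Space-like paths -/

/-- The relation `(n₁,t₁) ≺ (n₂,t₂)` on pairs (particle label, time). -/
def Prec (p q : ℕ × ℝ) : Prop := p.1 ≤ q.1 ∧ q.2 ≤ p.2 ∧ p ≠ q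

/-- A finite sequence of pairs (particle label, time) along a space-like path. -/
def IsSpaceLike {m : ℕ} (p : Fin m → ℕ × ℝ) : Prop := ∀ i j, i < j → Prec (p i) (p j)

/-! ### The kernel of PushASEP for general rates and initial positions

`v k` (`k ≥ 1`) are the rates and `y k` the initial positions of the particles; `a`, `b` are
the time-integrated right and left jump intensities.  `C` is the contour around `0`. -/

/-- `Psi C a b v y n t l` is the function `Ψ^{n,t}_{n-l}` on `ℤ`, where `l ≥ 1` may be larger
than `n`. -/
def Psi (C : Loop) (a b : ℝ → ℝ) (v : ℕ → ℝ) (y : ℕ → ℤ) (n : ℕ) (t : ℝ) (l : ℕ) (x : ℤ) : ℂ :=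
  C.integral fun z =>
    z ^ (x - y l - 1) * Complex.exp (a t / z + b t * z)
      * ((∏ j ∈ Finset.Icc 1 n, (1 - v j * z)) / ∏ j ∈ Finset.Icc 1 l, (1 - v j * z))

/-- The space `V_n`, spanned by the functions `x ↦ x^l u^x`, where `u` runs through the values
of `v_1, …, v_n` and `l` through the nonnegative integers below the multiplicity of `u`. -/
def V (v : ℕ → ℝ) (n : ℕ) : Submodule ℂ (ℤ → ℂ) :=
  Submodule.span ℂ {f | ∃ i ∈ Finset.Icc 1 n,
    ∃ l < ((Finset.Icc 1 n).filter fun j => v j = v i).card,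
      f = fun x : ℤ => (x : ℂ) ^ l * (v i : ℂ) ^ x}

/-- `Φ : Fin n → ℤ → ℂ` is the dual family `{Φ^{n,t}_{n-k}}`, `k = 1, …, n`: it is
biorthonormal to `{Ψ^{n,t}_{n-l}}`, `l = 1, …, n`, and spans `V_n`.  The function
`Φ^{n,t}_{n-k}` is stored at the index `k - 1` of `Fin n`. -/
def IsDualFamily (C : Loop) (a b : ℝ → ℝ) (v : ℕ → ℝ) (y : ℕ → ℤ) (n : ℕ) (t : ℝ)
    (Φ : Fin n → ℤ → ℂ) : Prop :=
  (∀ l k : Fin n,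
    HasSum (fun x : ℤ => Psi C a b v y n t (l + 1) x * Φ k x) (if k = l then 1 else 0)) ∧
  Submodule.span ℂ (Set.range Φ) = V v n

open Classical in
/-- The transition function `φ^{((n₁,t₁),(n₂,t₂))}(x₁,x₂)`. -/
def phi (C : Loop) (a b : ℝ → ℝ) (v : ℕ → ℝ) (p₁ : ℕ × ℝ) (x₁ : ℤ) (p₂ : ℕ × ℝ) (x₂ : ℤ) : ℂ :=
  if Prec p₁ p₂ then
    C.integral fun z =>
      1 / z ^ (x₂ - x₁ + 1)
        * (Complex.exp ((a p₁.2 - a p₂.2) / z) * Complex.exp ((b p₁.2 - b p₂.2) * z)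
          / ∏ j ∈ Finset.Icc (p₁.1 + 1) p₂.1, (1 - v j * z))
  else 0

/-- The kernel `K((n₁,t₁),x₁;(n₂,t₂),x₂)` of PushASEP:
`-φ^{((n₁,t₁),(n₂,t₂))}(x₁,x₂) + ∑_{k=1}^{n₂} Ψ^{n₁,t₁}_{n₁-k}(x₁) Φ^{n₂,t₂}_{n₂-k}(x₂)`,
for given dual families `Φ n t`. -/
def kernel (C : Loop) (a b : ℝ → ℝ) (v : ℕ → ℝ) (y : ℕ → ℤ)
    (Φ : (n : ℕ) → ℝ → Fin n → ℤ → ℂ) (p₁ : ℕ × ℝ) (x₁ : ℤ) (p₂ : ℕ × ℝ) (x₂ : ℤ) : ℂ :=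
  -phi C a b v p₁ x₁ p₂ x₂
    + ∑ k : Fin p₂.1, Psi C a b v y p₁.1 p₁.2 (k + 1) x₁ * Φ p₂.1 p₂.2 k x₂

/-! ### The explicit kernel for uniform rates and step initial condition -/

open Classical in
/-- The explicit kernel: a single integral over `Γ` plus a double integral with `w` on `Γ₀`
and `z` on `Γ₁`. -/
def stepKernel (Γ Γ₀ Γ₁ : Loop) (a b : ℝ → ℝ)
    (p₁ : ℕ × ℝ) (x₁ : ℤ) (p₂ : ℕ × ℝ) (x₂ : ℤ) : ℂ :=
  -(if Prec p₁ p₂ then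
      Γ.integral fun w =>
        1 / w ^ (x₁ - x₂ + 1) * (w / (1 - w)) ^ ((p₂.1 : ℤ) - p₁.1)
          * (Complex.exp (a p₁.2 * w + b p₁.2 / w) / Complex.exp (a p₂.2 * w + b p₂.2 / w))
    else 0)
  + Γ₀.integral fun w => Γ₁.integral fun z =>
      Complex.exp (b p₁.2 / w + a p₁.2 * w) / Complex.exp (b p₂.2 / z + a p₂.2 * z)
        * ((1 - w) ^ p₁.1 / w ^ (x₁ + p₁.1 + 1))
        * (z ^ (x₂ + p₂.1) / (1 - z) ^ p₂.1)
        * (1 / (w - z))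

end PushASEP

end

noncomputable section

namespace PushASEP

open MeasureTheory Set

/-! ### Integration along loops -/

/-! For unit rates `V_n` is the space of polynomials of degree `< n`, and the dual functions are
explicit residues at `1` (`stepDual`). As functions of `x` the `Ψ` are Laurent coefficients, so
summing against `u ^ x` reassembles the generating function at `1 / u`. The pairing then collapses
to the integral of `(u - 1) ^ (k - l - 1)` around `1`, which is the Kronecker delta
(`hasSum_Psi_mul_stepDual`). A dimension count gives the span, and biorthogonality gives uniqueness.

For the kernel, put `w = 1 / z`. A loop around `0` but not `1` becomes a clockwise loop around both,
so `Ψ` and `φ` each split into a part around `0` and a part around `1`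
(`integral_eq_add_of_inversion`). In the sum of the `Ψ Φ`, the parts around `0` form the double
integral, because the inner integral of `1 / (w - z)` is a finite sum of powers of `w - 1`
(`stepKernel_double_integral`). The parts around `1` add up to one residue of a product
(`sum_integral_mul_integral`). That residue cancels the part of `φ` around `1`, or vanishes when
there is no pole. What remains of `φ` is the single integral. The sign comes from replacing `1 - w`
and `1 - z` by `w - 1` and `z - 1`; it is a diagonal conjugation.

Contours enter only through winding numbers. The residue theorems give integrals as combinations of
winding numbers whose coefficients depend on the integrand alone, so no contour is ever deformed. -/

/-- The trace of a loop. -/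
def Loop.trace (γ : Loop) : Set ℂ := γ.path '' Icc 0 1

theorem Loop.path_mem_trace (γ : Loop) {s : ℝ} (hs : s ∈ Icc (0 : ℝ) 1) :
    γ.path s ∈ γ.trace := mem_image_of_mem _ hs

theorem Loop.isCompact_trace (γ : Loop) : IsCompact γ.trace :=
  isCompact_Icc.image_of_continuousOn γ.continuousOn_path

theorem Loop.trace_nonempty (γ : Loop) : γ.trace.Nonempty :=
  ⟨_, γ.path_mem_trace (left_mem_Icc.2 zero_le_one)⟩

theorem Loop.Avoids.subset {γ : Loop} {p : ℂ} (h : γ.Avoids p) : γ.trace ⊆ {p}ᶜ := by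
  rintro _ ⟨s, hs, rfl⟩
  exact h s hs

theorem Loop.Avoids.ne {γ : Loop} {p z : ℂ} (h : γ.Avoids p) (hz : z ∈ γ.trace) : z ≠ p :=
  h.subset hz

theorem Loop.continuousOn_comp (γ : Loop) {f : ℂ → ℂ} (hf : ContinuousOn f γ.trace) :
    ContinuousOn (fun s => f (γ.path s)) (Icc 0 1) :=
  hf.comp γ.continuousOn_path (mapsTo_image _ _)

theorem Loop.intervalIntegrable (γ : Loop) {f : ℂ → ℂ} (hf : ContinuousOn f γ.trace) :
    IntervalIntegrable (fun s => f (γ.path s) * deriv γ.path s) volume 0 1 := by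
  refine γ.integrable_deriv.continuousOn_mul ?_
  rw [uIcc_of_le zero_le_one]
  exact γ.continuousOn_comp hf

theorem Loop.integral_congr (γ : Loop) {f g : ℂ → ℂ} (h : EqOn f g γ.trace) :
    γ.integral f = γ.integral g := by
  unfold Loop.integral
  congr 1
  refine intervalIntegral.integral_congr fun s hs => ?_
  rw [uIcc_of_le zero_le_one] at hs
  simp only [h (γ.path_mem_trace hs)]

theorem Loop.integral_const_mul (γ : Loop) (c : ℂ) (f : ℂ → ℂ) :
    γ.integral (fun z => c * f z) = c * γ.integral f := by
  simp only [Loop.integral, mul_assoc, intervalIntegral.integral_const_mul]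
  ring

theorem Loop.integral_mul_const (γ : Loop) (c : ℂ) (f : ℂ → ℂ) :
    γ.integral (fun z => f z * c) = γ.integral f * c := by
  simp_rw [mul_comm _ c]
  exact γ.integral_const_mul c f

theorem Loop.integral_add (γ : Loop) {f g : ℂ → ℂ} (hf : ContinuousOn f γ.trace)
    (hg : ContinuousOn g γ.trace) :
    γ.integral (fun z => f z + g z) = γ.integral f + γ.integral g := by
  simp only [Loop.integral, add_mul]
  rw [intervalIntegral.integral_add (γ.intervalIntegrable hf) (γ.intervalIntegrable hg), mul_add]

theorem Loop.integral_sub (γ : Loop) {f g : ℂ → ℂ} (hf : ContinuousOn f γ.trace)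
    (hg : ContinuousOn g γ.trace) :
    γ.integral (fun z => f z - g z) = γ.integral f - γ.integral g := by
  simp only [Loop.integral, sub_mul]
  rw [intervalIntegral.integral_sub (γ.intervalIntegrable hf) (γ.intervalIntegrable hg), mul_sub]

theorem Loop.integral_finsetSum {ι : Type*} (γ : Loop) (S : Finset ι) {f : ι → ℂ → ℂ}
    (hf : ∀ i ∈ S, ContinuousOn (f i) γ.trace) :
    γ.integral (fun z => ∑ i ∈ S, f i z) = ∑ i ∈ S, γ.integral (f i) := by
  simp only [Loop.integral, Finset.sum_mul]
  rw [intervalIntegral.integral_finsetSum fun i hi => γ.intervalIntegrable (hf i hi),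
    Finset.mul_sum]

/-- Termwise integration of a series dominated on the trace of a loop. -/
theorem Loop.hasSum_integral {ι : Type*} [Countable ι] (γ : Loop) {F : ι → ℂ → ℂ} {f : ℂ → ℂ}
    {B : ι → ℝ} (hF : ∀ i, ContinuousOn (F i) γ.trace) (hB : ∀ i, ∀ z ∈ γ.trace, ‖F i z‖ ≤ B i)
    (hs : Summable B) (h : ∀ z ∈ γ.trace, HasSum (fun i => F i z) (f z)) :
    HasSum (fun i => γ.integral (F i)) (γ.integral f) := by
  refine HasSum.mul_left _ ?_
  have hmem : ∀ s ∈ uIoc (0 : ℝ) 1, γ.path s ∈ γ.trace := fun s hs => by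
    rw [uIoc_of_le zero_le_one] at hs
    exact γ.path_mem_trace (Ioc_subset_Icc_self hs)
  refine intervalIntegral.hasSum_integral_of_dominated_convergence
    (fun i s => B i * ‖deriv γ.path s‖) (fun i => ?_) (fun i => ?_) ?_ ?_ ?_
  · exact (γ.intervalIntegrable (hF i)).aestronglyMeasurable_restrict_uIoc
  · refine ae_of_all _ fun s hs => ?_
    rw [norm_mul]
    exact mul_le_mul_of_nonneg_right (hB i _ (hmem s hs)) (norm_nonneg _)
  · exact ae_of_all _ fun s _ => hs.mul_right _
  · simp_rw [tsum_mul_right]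
    exact γ.integrable_deriv.norm.const_mul _
  · exact ae_of_all _ fun s hs => (h _ (hmem s hs)).mul_right _

/-- A function with a primitive integrates to zero. -/
theorem Loop.integral_eq_zero_of_hasDerivAt (γ : Loop) {H f : ℂ → ℂ}
    (hH : ∀ z ∈ γ.trace, HasDerivAt H (f z) z) (hf : ContinuousOn f γ.trace) :
    γ.integral f = 0 := by
  obtain ⟨S, hS⟩ := γ.differentiable_off_corners
  have hc : ContinuousOn H γ.trace := fun z hz => (hH z hz).continuousAt.continuousWithinAt
  have := integral_eq_of_hasDerivAt_off_countable_of_le (fun s => H (γ.path s))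
    (fun s => f (γ.path s) * deriv γ.path s) zero_le_one S.countable_toSet
    (γ.continuousOn_comp hc) (fun s hs => ?_) (γ.intervalIntegrable hf)
  · rw [Loop.integral, this, γ.closed, sub_self, mul_zero]
  · exact (hH _ (γ.path_mem_trace (Ioo_subset_Icc_self hs.1))).comp s (hS s hs.1 hs.2).hasDerivAt

/-- Every power except `-1` has a single-valued primitive off `p`. -/
theorem Loop.integral_zpow (γ : Loop) {p : ℂ} (h : γ.Avoids p) {m : ℤ} (hm : m ≠ -1) :
    γ.integral (fun z => (z - p) ^ m) = 0 := by
  have hm' : (m + 1 : ℂ) ≠ 0 := by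
    exact_mod_cast fun h => hm (by omega : m = -1)
  refine γ.integral_eq_zero_of_hasDerivAt (H := fun z => (m + 1 : ℂ)⁻¹ * (z - p) ^ (m + 1))
    (fun z hz => ?_) fun z hz => ?_
  · have hz' : z - p ≠ 0 := sub_ne_zero.2 (h.ne hz)
    have := ((hasDerivAt_zpow (m + 1) (z - p) (Or.inl hz')).comp_sub_const z p).const_mul
      (m + 1 : ℂ)⁻¹
    refine this.congr_deriv ?_
    push_cast
    rw [← mul_assoc, inv_mul_cancel₀ hm', one_mul, add_sub_cancel_right]
  · exact ((continuousAt_id.sub continuousAt_const).zpow₀ m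
      (Or.inl (sub_ne_zero.2 (h.ne hz)))).continuousWithinAt

/-! ### Holomorphic functions on the punctured plane -/

/-- A holomorphic function on the punctured plane has a primitive, up to a multiple of `1 / z`. -/
theorem exists_primitive_punctured {f : ℂ → ℂ} (hf : DifferentiableOn ℂ f {0}ᶜ) :
    ∃ (c : ℂ) (H : ℂ → ℂ), ∀ z ≠ 0, HasDerivAt H (f z - c * z⁻¹) z := by
  -- Pull back along `exp`: the form `f(z) dz` becomes entire and has a primitive `G` on the whole
  -- plane.
  have hd : ∀ c : ℂ, Differentiable ℂ fun u => f (Complex.exp u) * Complex.exp u - c := fun c u =>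
    (((hf.differentiableAt (isOpen_compl_singleton.mem_nhds (Complex.exp_ne_zero u))).comp u
      Complex.differentiable_exp.differentiableAt).mul
      Complex.differentiable_exp.differentiableAt).sub_const c
  obtain ⟨G, hG⟩ := (hd 0).isExactOn_univ
  simp only [mem_univ, forall_const, sub_zero] at hG
  -- The residue: the slope to subtract so that `G u - c * u` has period `2πi` and descends through
  -- the logarithm.
  set c : ℂ := (G (2 * Real.pi * Complex.I) - G 0) / (2 * Real.pi * Complex.I) with hc
  set P : ℂ → ℂ := fun u => G u - c * u with hP
  have hP' : ∀ u, HasDerivAt P (f (Complex.exp u) * Complex.exp u - c) u := fun u => by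
    simpa using (hG u).fun_sub ((hasDerivAt_id' u).const_mul c)
  have hper : Function.Periodic P (2 * Real.pi * Complex.I) := by
    have hQ : ∀ u, HasDerivAt (fun u => P (u + 2 * Real.pi * Complex.I) - P u) 0 u := fun u => by
      have := ((hP' (u + 2 * Real.pi * Complex.I)).comp_add_const u _).fun_sub (hP' u)
      simpa only [Complex.exp_periodic u, sub_self] using this
    intro u
    have := is_const_of_deriv_eq_zero (fun u => (hQ u).differentiableAt) (fun u => (hQ u).deriv) u 0
    have h0 : P (0 + 2 * Real.pi * Complex.I) - P 0 = 0 := by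
      simp only [hP, hc, zero_add, mul_zero, sub_zero]
      rw [div_mul_cancel₀ _ Complex.two_pi_I_ne_zero]
      ring
    exact sub_eq_zero.1 (this.trans h0)
  have key : ∀ z u : ℂ, Complex.exp u = z → P (Complex.log z) = P u := by
    rintro _ u rfl
    obtain ⟨n, hn⟩ := Complex.exp_eq_exp_iff_exists_int.1
      (Complex.exp_log (Complex.exp_ne_zero u))
    rw [hn]
    exact hper.int_mul n u
  refine ⟨c, fun z => P (Complex.log z), fun z hz => ?_⟩
  -- A branch of the logarithm that is holomorphic near `z` even on the cut; by periodicity it gives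
  -- the same function.
  have hlog : HasDerivAt (fun w => P (Complex.log z + Complex.log (w / z)))
      (f z - c * z⁻¹) z := by
    have h1 : HasDerivAt (fun w : ℂ => w / z) (1 / z) z := (hasDerivAt_id z).div_const z
    have h2 : HasDerivAt (fun w => Complex.log z + Complex.log (w / z)) (z⁻¹) z := by
      have := (h1.clog (by simp [div_self hz])).const_add (Complex.log z)
      simpa [div_self hz] using this
    have h3 : Complex.log z + Complex.log (z / z) = Complex.log z := by simp [div_self hz]
    have h4 := (hP' (Complex.log z + Complex.log (z / z))).comp z h2
    rw [h3, Complex.exp_log hz, sub_mul, mul_assoc, mul_inv_cancel₀ hz, mul_one] at h4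
    exact h4
  refine hlog.congr_of_eventuallyEq ?_
  filter_upwards [isOpen_ne.mem_nhds hz] with w hw
  refine key w _ ?_
  rw [Complex.exp_add, Complex.exp_log hz, Complex.exp_log (div_ne_zero hw hz),
    mul_div_cancel₀ _ hz]

theorem Loop.winding_zero (γ : Loop) : γ.winding 0 = γ.integral fun z => z⁻¹ := by
  simp [Loop.winding]

/-- The residue theorem on the punctured plane. -/
theorem exists_integral_eq_mul_winding {f : ℂ → ℂ} (hf : DifferentiableOn ℂ f {0}ᶜ) :
    ∃ c : ℂ, ∀ γ : Loop, γ.Avoids 0 → γ.integral f = c * γ.winding 0 := by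
  obtain ⟨c, H, hH⟩ := exists_primitive_punctured hf
  refine ⟨c, fun γ hγ => ?_⟩
  have hi : ContinuousOn (fun z : ℂ => c * z⁻¹) γ.trace :=
    continuousOn_const.mul (continuousOn_inv₀.mono hγ.subset)
  have hfc := hf.continuousOn.mono hγ.subset
  have := γ.integral_eq_zero_of_hasDerivAt (fun z hz => hH z (hγ.ne hz)) (hfc.sub hi)
  rw [γ.integral_sub hfc hi, γ.integral_const_mul, ← γ.winding_zero] at this
  exact sub_eq_zero.1 this

theorem Loop.integral_eq_zero_of_excludes {γ : Loop} (h : γ.Excludes 0) {f : ℂ → ℂ}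
    (hf : DifferentiableOn ℂ f {0}ᶜ) : γ.integral f = 0 := by
  obtain ⟨c, hc⟩ := exists_integral_eq_mul_winding hf
  rw [hc γ h.1, h.2, mul_zero]

/-- The divided difference stays in the same class of functions, so poles at `p` can be lowered one
order at a time by `f z = f p + (z - p) * dslope f p z`. -/
theorem differentiableOn_dslope_punctured {f : ℂ → ℂ} (hf : DifferentiableOn ℂ f {0}ᶜ) {p : ℂ}
    (hp : p ≠ 0) : DifferentiableOn ℂ (dslope f p) {0}ᶜ :=
  (Complex.differentiableOn_dslope (isOpen_compl_singleton.mem_nhds hp)).2 hf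

theorem eq_add_mul_dslope (f : ℂ → ℂ) (p z : ℂ) : f z = f p + (z - p) * dslope f p z := by
  have := sub_smul_dslope f p z
  rw [smul_eq_mul] at this
  rw [this]
  ring

theorem continuousOn_sub_zpow (p : ℂ) (m : ℤ) : ContinuousOn (fun z : ℂ => (z - p) ^ m) {p}ᶜ :=
  fun _ hz => ((continuousAt_id.sub continuousAt_const).zpow₀ m
      (Or.inl (sub_ne_zero.2 hz))).continuousWithinAt

theorem differentiableOn_zpow_punctured (m : ℤ) :
    DifferentiableOn ℂ (fun z : ℂ => z ^ m) {0}ᶜ :=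
  differentiableOn_zpow m _ (Or.inl (by simp))

theorem differentiableOn_mul_sub_zpow {f : ℂ → ℂ} (hf : DifferentiableOn ℂ f {0}ᶜ) (p : ℂ)
    {m : ℤ} (hm : 0 ≤ m) : DifferentiableOn ℂ (fun z => f z * (z - p) ^ m) {0}ᶜ := by
  lift m to ℕ using hm
  simp_rw [zpow_natCast]
  exact hf.mul ((differentiable_id.sub_const p).pow m).differentiableOn

/-- The residue theorem for a holomorphic function on the punctured plane times a power of
`z - p`. -/
theorem exists_integral_mul_zpow_eq {f : ℂ → ℂ} (hf : DifferentiableOn ℂ f {0}ᶜ) {p : ℂ}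
    (hp : p ≠ 0) (m : ℤ) : ∃ A B : ℂ, ∀ γ : Loop, γ.Avoids 0 → γ.Avoids p →
      γ.integral (fun z => f z * (z - p) ^ m) = A * γ.winding 0 + B * γ.winding p := by
  rcases le_or_gt 0 m with hm | hm
  · obtain ⟨c, hc⟩ := exists_integral_eq_mul_winding (differentiableOn_mul_sub_zpow hf p hm)
    exact ⟨c, 0, fun γ h _ => by rw [hc γ h]; ring⟩
  · obtain ⟨k, rfl⟩ : ∃ k : ℕ, m = -k := ⟨m.natAbs, by omega⟩
    clear hm
    induction k generalizing f with
    | zero =>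
      obtain ⟨c, hc⟩ := exists_integral_eq_mul_winding hf
      exact ⟨c, 0, fun γ h _ => by simp [hc γ h]⟩
    | succ k ih =>
      have hd := differentiableOn_dslope_punctured hf hp
      obtain ⟨A, B, hAB⟩ := ih hd
      -- The split-off term `f p * (z - p) ^ (-(k + 1))` has a nonzero residue only for `k = 0`.
      refine ⟨A, B + if k = 0 then f p else 0, fun γ h0 hγ => ?_⟩
      have hz : ∀ m, ContinuousOn (fun z : ℂ => (z - p) ^ (m : ℤ)) γ.trace := fun m =>
        (continuousOn_sub_zpow p m).mono hγ.subset
      have e : γ.integral (fun z => f z * (z - p) ^ (-((k + 1 : ℕ) : ℤ))) =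
          γ.integral fun z => f p * (z - p) ^ (-((k + 1 : ℕ) : ℤ))
            + dslope f p z * (z - p) ^ (-(k : ℤ)) := by
        refine γ.integral_congr fun z hz => ?_
        have hzp := sub_ne_zero.2 (hγ.ne hz)
        have : (z - p) ^ (-(k : ℤ)) = (z - p) * (z - p) ^ (-((k + 1 : ℕ) : ℤ)) := by
          rw [← zpow_one_add₀ hzp]
          congr 1
          push_cast
          ring
        rw [this]
        conv_lhs => rw [eq_add_mul_dslope f p z]
        ring
      rw [e, γ.integral_add (continuousOn_const.fun_mul (hz _))
        ((hd.continuousOn.mono h0.subset).fun_mul (hz _)), hAB γ h0 hγ, γ.integral_const_mul]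
      split_ifs with hk
      · subst hk
        simp only [zero_add, Nat.cast_one, zpow_neg_one]
        rw [← Loop.winding]
        ring
      · rw [γ.integral_zpow hγ (by omega)]
        ring

/-! ### Laurent expansions -/

theorem Loop.exists_norm_integral_le (γ : Loop) : ∃ L : ℝ, 0 ≤ L ∧ ∀ (f : ℂ → ℂ) (B : ℝ),
    (∀ z ∈ γ.trace, ‖f z‖ ≤ B) → ‖γ.integral f‖ ≤ L * B := by
  refine ⟨‖(2 * Real.pi * Complex.I : ℂ)⁻¹‖ * ∫ s in (0 : ℝ)..1, ‖deriv γ.path s‖, ?_,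
    fun f B hB => ?_⟩
  · refine mul_nonneg (norm_nonneg _) ?_
    exact (intervalIntegral.integral_nonneg zero_le_one fun _ _ => norm_nonneg _)
  · rw [Loop.integral, norm_mul, mul_assoc ‖(2 * Real.pi * Complex.I : ℂ)⁻¹‖]
    refine mul_le_mul_of_nonneg_left ?_ (norm_nonneg _)
    rw [← intervalIntegral.integral_mul_const]
    refine intervalIntegral.norm_integral_le_of_norm_le zero_le_one
      (ae_of_all _ fun s hs => ?_) (γ.integrable_deriv.norm.mul_const _)
    rw [norm_mul, mul_comm]
    exact mul_le_mul_of_nonneg_left (hB _ (γ.path_mem_trace (Ioc_subset_Icc_self hs)))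
      (norm_nonneg _)

/-! ### Circles as reference loops. -/

/-- The circle of radius `r` around `0`. -/
def circleLoop (r : ℝ) : Loop where
  path s := r * Complex.exp (2 * Real.pi * Complex.I * s)
  continuousOn_path := by fun_prop
  closed := by simp [Complex.exp_two_pi_mul_I]
  differentiable_off_corners := ⟨∅, fun s _ _ => by
    have : DifferentiableAt ℝ (fun s : ℝ => (s : ℂ)) s := Complex.ofRealCLM.differentiableAt
    fun_prop⟩
  integrable_deriv := by
    have h : ∀ s : ℝ, HasDerivAt (fun s : ℝ => (r : ℂ) * Complex.exp (2 * Real.pi * Complex.I * s))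
        (r * (Complex.exp (2 * Real.pi * Complex.I * s) * (2 * Real.pi * Complex.I * 1))) s :=
      fun s => (((Complex.ofRealCLM.hasDerivAt (x := s)).const_mul _).cexp).const_mul _
    rw [show deriv (fun s : ℝ => (r : ℂ) * Complex.exp (2 * Real.pi * Complex.I * s)) = _ from
      funext fun s => (h s).deriv]
    exact Continuous.intervalIntegrable (by fun_prop) _ _

theorem norm_of_mem_trace_circleLoop {r : ℝ} (hr : 0 < r) {z : ℂ}
    (hz : z ∈ (circleLoop r).trace) : ‖z‖ = r := by
  obtain ⟨s, -, rfl⟩ := hz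
  have : (2 * Real.pi * Complex.I * s : ℂ) = ((2 * Real.pi * s : ℝ) : ℂ) * Complex.I := by
    push_cast
    ring
  simp only [circleLoop]
  rw [norm_mul, this, Complex.norm_exp_ofReal_mul_I, mul_one, Complex.norm_real,
    Real.norm_of_nonneg hr.le]

theorem circleLoop_avoids_zero {r : ℝ} (hr : 0 < r) : (circleLoop r).Avoids 0 := fun s hs h => by
  have := norm_of_mem_trace_circleLoop hr ((circleLoop r).path_mem_trace hs)
  rw [h, norm_zero] at this
  exact hr.ne this

theorem circleLoop_includes_zero {r : ℝ} (hr : 0 < r) : (circleLoop r).Includes 0 := by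
  refine ⟨circleLoop_avoids_zero hr, ?_⟩
  have h : ∀ s : ℝ, HasDerivAt (circleLoop r).path
      (r * (Complex.exp (2 * Real.pi * Complex.I * s) * (2 * Real.pi * Complex.I * 1))) s :=
    fun s => (((Complex.ofRealCLM.hasDerivAt (x := s)).const_mul _).cexp).const_mul _
  rw [Loop.winding_zero, Loop.integral]
  have e : ∀ s : ℝ, ((circleLoop r).path s)⁻¹ * deriv (circleLoop r).path s
      = 2 * Real.pi * Complex.I := fun s => by
    rw [(h s).deriv]
    simp only [circleLoop]
    field_simp [Complex.exp_ne_zero, hr.ne']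
  simp only [e, intervalIntegral.integral_const, sub_zero, one_smul]
  exact inv_mul_cancel₀ Complex.two_pi_I_ne_zero

/-- Allows a given loop to be exchanged for a circle of any radius, where estimates are easy. -/
theorem Loop.Includes.integral_eq {γ γ' : Loop} (h : γ.Includes 0) (h' : γ'.Includes 0)
    {f : ℂ → ℂ} (hf : DifferentiableOn ℂ f {0}ᶜ) : γ.integral f = γ'.integral f := by
  obtain ⟨c, hc⟩ := exists_integral_eq_mul_winding hf
  rw [hc γ h.1, hc γ' h'.1, h.2, h'.2]

/-- Expansion of a Cauchy integral at a point inside a loop. -/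
theorem Loop.hasSum_cauchy_inside (γ : Loop) {f : ℂ → ℂ} (hf : ContinuousOn f γ.trace) {u : ℂ}
    {r : ℝ} (hu : ‖u‖ < r) (hr : ∀ z ∈ γ.trace, r ≤ ‖z‖) :
    HasSum (fun n : ℕ => γ.integral (fun z => f z * z ^ (-(n : ℤ) - 1)) * u ^ n)
      (γ.integral fun z => f z * (z - u)⁻¹) := by
  obtain ⟨M, hM⟩ := γ.isCompact_trace.exists_bound_of_continuousOn hf
  have hr0 : 0 < r := (norm_nonneg u).trans_lt hu
  have h0 : ∀ z ∈ γ.trace, z ≠ 0 := fun z hz =>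
    norm_pos_iff.1 (hr0.trans_le (hr z hz))
  have hM0 : 0 ≤ M := by
    obtain ⟨z, hz⟩ := γ.trace_nonempty
    exact (norm_nonneg _).trans (hM z hz)
  simp_rw [← Loop.integral_mul_const]
  have e : ∀ z ∈ γ.trace, ∀ n : ℕ, f z * z ^ (-(n : ℤ) - 1) * u ^ n = f z * z⁻¹ * (u / z) ^ n :=
    fun z hz n => by
      rw [zpow_sub_one₀ (h0 z hz), zpow_neg, zpow_natCast, div_pow]
      field_simp
  refine γ.hasSum_integral (B := fun n => M * r⁻¹ * (‖u‖ / r) ^ n) (fun n => ?_) (fun n z hz => ?_)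
    ?_ fun z hz => ?_
  · refine (hf.mul ?_).mul continuousOn_const
    exact (differentiableOn_zpow_punctured _).continuousOn.mono fun z hz => h0 z hz
  · rw [e z hz, norm_mul, norm_mul, norm_pow, norm_div, norm_inv]
    have := hM z hz
    have := hr z hz
    gcongr
  · exact (summable_geometric_of_lt_one (by positivity) ((div_lt_one hr0).2 hu)).mul_left _
  · have hlt : ‖u / z‖ < 1 := by
      rw [norm_div, div_lt_one (norm_pos_iff.2 (h0 z hz))]
      exact hu.trans_le (hr z hz)
    simp_rw [e z hz]
    have := (hasSum_geometric_of_norm_lt_one hlt).mul_left (f z * z⁻¹)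
    have hz0 := h0 z hz
    have : f z * z⁻¹ * (1 - u / z)⁻¹ = f z * (z - u)⁻¹ := by
      rw [mul_assoc, ← mul_inv]
      congr 2
      field_simp
    rwa [← this]

/-- Expansion of a Cauchy integral at a point outside a loop. -/
theorem Loop.hasSum_cauchy_outside (γ : Loop) {f : ℂ → ℂ} (hf : ContinuousOn f γ.trace) {u : ℂ}
    {r : ℝ} (hu : r < ‖u‖) (hr : ∀ z ∈ γ.trace, ‖z‖ ≤ r) :
    HasSum (fun n : ℕ => γ.integral (fun z => f z * z ^ (n : ℤ)) * u ^ (-((n : ℤ) + 1)))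
      (-γ.integral fun z => f z * (z - u)⁻¹) := by
  obtain ⟨M, hM⟩ := γ.isCompact_trace.exists_bound_of_continuousOn hf
  obtain ⟨hr0, hM0⟩ : 0 ≤ r ∧ 0 ≤ M := by
    obtain ⟨z, hz⟩ := γ.trace_nonempty
    exact ⟨(norm_nonneg _).trans (hr z hz), (norm_nonneg _).trans (hM z hz)⟩
  have hu0 : u ≠ 0 := norm_pos_iff.1 (hr0.trans_lt hu)
  simp_rw [← Loop.integral_mul_const]
  rw [← neg_one_mul, ← Loop.integral_const_mul]
  have e : ∀ (z : ℂ) (n : ℕ), f z * z ^ (n : ℤ) * u ^ (-((n : ℤ) + 1))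
      = f z * u⁻¹ * (z / u) ^ n :=
    fun z n => by
      rw [zpow_neg, zpow_add_one₀ hu0, zpow_natCast, zpow_natCast, div_pow]
      field_simp
  refine γ.hasSum_integral (B := fun n => M * ‖u‖⁻¹ * (r / ‖u‖) ^ n) (fun n => ?_)
    (fun n z hz => ?_) ?_ fun z hz => ?_
  · refine (hf.mul ?_).mul continuousOn_const
    simp_rw [zpow_natCast]
    fun_prop
  · rw [e, norm_mul, norm_mul, norm_pow, norm_div, norm_inv]
    have := hM z hz
    have := hr z hz
    gcongr
  · exact (summable_geometric_of_lt_one (by positivity)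
      ((div_lt_one (norm_pos_iff.2 hu0)).2 hu)).mul_left _
  · have hlt : ‖z / u‖ < 1 := by
      rw [norm_div, div_lt_one (norm_pos_iff.2 hu0)]
      exact (hr z hz).trans_lt hu
    simp_rw [e]
    have := (hasSum_geometric_of_norm_lt_one hlt).mul_left (f z * u⁻¹)
    have : f z * u⁻¹ * (1 - z / u)⁻¹ = -1 * (f z * (z - u)⁻¹) := by
      rw [mul_assoc, ← mul_inv, mul_sub, mul_one, mul_div_cancel₀ _ hu0, ← neg_sub z u, inv_neg]
      ring
    rwa [← this]

/-- In the geometric series for `1 / (z - u)` only the term `n = 0` has a nonzero integral. -/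
theorem circleLoop_winding_inside {r : ℝ} {u : ℂ} (hu : ‖u‖ < r) :
    (circleLoop r).winding u = 1 := by
  have hr : 0 < r := (norm_nonneg u).trans_lt hu
  have h := (circleLoop r).hasSum_cauchy_inside (f := fun _ => 1) continuousOn_const hu
    fun z hz => (norm_of_mem_trace_circleLoop hr hz).ge
  simp only [one_mul] at h
  have h' := hasSum_single (f := fun n : ℕ =>
    (circleLoop r).integral (fun z => z ^ (-(n : ℤ) - 1)) * u ^ n) 0 fun n hn => by
      have := (circleLoop r).integral_zpow (circleLoop_avoids_zero hr)
        (m := -(n : ℤ) - 1) (by omega)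
      simp only [sub_zero] at this
      simp only [this, zero_mul]
  rw [Loop.winding, h.unique h']
  simpa [Loop.winding_zero] using (circleLoop_includes_zero hr).2

theorem circleLoop_winding_outside {r : ℝ} (hr : 0 < r) {u : ℂ} (hu : r < ‖u‖) :
    (circleLoop r).winding u = 0 := by
  have h := (circleLoop r).hasSum_cauchy_outside (f := fun _ => 1) continuousOn_const hu
    fun z hz => (norm_of_mem_trace_circleLoop hr hz).le
  have h0 : ∀ n : ℕ, (circleLoop r).integral (fun z => z ^ (n : ℤ)) = 0 := fun n => by
    have := (circleLoop r).integral_zpow (circleLoop_avoids_zero hr) (m := n) (by omega)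
    simpa only [sub_zero] using this
  simp only [one_mul, h0, zero_mul] at h
  exact neg_eq_zero.1 (h.unique hasSum_zero)

/-- Cauchy's formula with a remainder. The remainder has no pole at `u`, so it takes the same value
on circles inside and outside `u`. -/
theorem Loop.integral_mul_sub_inv (γ : Loop) {f : ℂ → ℂ} (hf : DifferentiableOn ℂ f {0}ᶜ) {u : ℂ}
    (hu : u ≠ 0) (h0 : γ.Avoids 0) (h : γ.Avoids u) :
    γ.integral (fun z => f z * (z - u)⁻¹) = f u * γ.winding u + γ.integral (dslope f u) := by
  have hi : ContinuousOn (fun z : ℂ => (z - u)⁻¹) γ.trace := by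
    simpa only [zpow_neg_one] using (continuousOn_sub_zpow u (-1)).mono h.subset
  rw [Loop.winding, ← γ.integral_const_mul, ← γ.integral_add (continuousOn_const.fun_mul hi)
    ((differentiableOn_dslope_punctured hf hu).continuousOn.mono h0.subset)]
  refine γ.integral_congr fun z hz => ?_
  have hz' := sub_ne_zero.2 (h.ne hz)
  rw [eq_add_mul_dslope f u z]
  field_simp

/-- The Laurent expansion of a holomorphic function on the punctured plane. -/
theorem hasSum_laurent {γ : Loop} (h : γ.Includes 0) {f : ℂ → ℂ}
    (hf : DifferentiableOn ℂ f {0}ᶜ) {u : ℂ} (hu : u ≠ 0) :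
    HasSum (fun m : ℤ => γ.integral (fun z => f z * z ^ (-m - 1)) * u ^ m) (f u) := by
  have hn : 0 < ‖u‖ := norm_pos_iff.2 hu
  have hr : 0 < ‖u‖ / 2 := by positivity
  have hR : 0 < 2 * ‖u‖ := by positivity
  have hru : ‖u‖ / 2 < ‖u‖ := by linarith
  have huR : ‖u‖ < 2 * ‖u‖ := by linarith
  have hd : ∀ m : ℤ, DifferentiableOn ℂ (fun z => f z * z ^ m) {0}ᶜ := fun m =>
    hf.mul (differentiableOn_zpow_punctured m)
  have hin := (circleLoop (2 * ‖u‖)).hasSum_cauchy_inside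
    (hf.continuousOn.mono (circleLoop_avoids_zero hR).subset) huR
    fun z hz => (norm_of_mem_trace_circleLoop hR hz).ge
  have hout := (circleLoop (‖u‖ / 2)).hasSum_cauchy_outside
    (hf.continuousOn.mono (circleLoop_avoids_zero hr).subset) hru
    fun z hz => (norm_of_mem_trace_circleLoop hr hz).le
  have hne : ∀ {r : ℝ}, 0 < r → ‖u‖ ≠ r → (circleLoop r).Avoids u := fun {r} hr0 hur s hs hsu =>
    hur (by rw [← hsu]
            exact norm_of_mem_trace_circleLoop hr0 ((circleLoop r).path_mem_trace hs))
  rw [Loop.integral_mul_sub_inv _ hf hu (circleLoop_avoids_zero hR) (hne hR huR.ne),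
    circleLoop_winding_inside huR, mul_one] at hin
  rw [Loop.integral_mul_sub_inv _ hf hu (circleLoop_avoids_zero hr) (hne hr hru.ne'),
    circleLoop_winding_outside hr hru, mul_zero, zero_add,
    (circleLoop_includes_zero hr).integral_eq (circleLoop_includes_zero hR)
      (differentiableOn_dslope_punctured hf hu)] at hout
  -- The outer circle supplies the nonnegative powers, the inner one the negative powers; their
  -- remainders cancel.
  have key := HasSum.of_nat_of_neg_add_one
    (f := fun m : ℤ => γ.integral (fun z => f z * z ^ (-m - 1)) * u ^ m)
    (m := f u + (circleLoop (2 * ‖u‖)).integral (dslope f u))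
    (m' := -(circleLoop (2 * ‖u‖)).integral (dslope f u)) ?_ ?_
  · simpa using key
  · refine hin.congr_fun fun n => ?_
    rw [h.integral_eq (circleLoop_includes_zero hR) (hd _), zpow_natCast]
  · refine hout.congr_fun fun n => ?_
    rw [h.integral_eq (circleLoop_includes_zero hr) (hd _)]
    congr 3
    ext z
    congr 2
    ring

/-- Cauchy's estimate on the circle of radius `r`; all radii are available because `f` is
holomorphic off `0`. -/
theorem exists_coeff_bound {γ : Loop} (h : γ.Includes 0) {f : ℂ → ℂ}
    (hf : DifferentiableOn ℂ f {0}ᶜ) {r : ℝ} (hr : 0 < r) :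
    ∃ M, 0 ≤ M ∧ ∀ m : ℤ, ‖γ.integral (fun z => f z * z ^ m)‖ ≤ M * r ^ m := by
  have hc := circleLoop_includes_zero hr
  obtain ⟨L, hL0, hL⟩ := (circleLoop r).exists_norm_integral_le
  obtain ⟨N, hN⟩ := (circleLoop r).isCompact_trace.exists_bound_of_continuousOn
    (hf.continuousOn.mono hc.1.subset)
  obtain ⟨z₀, hz₀⟩ := (circleLoop r).trace_nonempty
  refine ⟨L * N, mul_nonneg hL0 ((norm_nonneg _).trans (hN _ hz₀)), fun m => ?_⟩
  rw [h.integral_eq hc (hf.fun_mul (differentiableOn_zpow_punctured m)), mul_assoc]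
  refine hL _ _ fun z hz => ?_
  rw [norm_mul, norm_zpow, norm_of_mem_trace_circleLoop hr hz]
  exact mul_le_mul_of_nonneg_right (hN z hz) (by positivity)

/-- The Laurent series converges normally on compact sets. -/
theorem exists_laurent_bound {γ : Loop} (h : γ.Includes 0) {f : ℂ → ℂ}
    (hf : DifferentiableOn ℂ f {0}ᶜ) {K : Set ℂ} (hK : IsCompact K) (hK0 : K ⊆ {0}ᶜ) :
    ∃ B : ℤ → ℝ, Summable B ∧ ∀ m, ∀ u ∈ K,
      ‖γ.integral (fun z => f z * z ^ (-m - 1)) * u ^ m‖ ≤ B m := by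
  obtain ⟨R, hR0, hR⟩ : ∃ R > 0, ∀ u ∈ K, ‖u‖ ≤ R := by
    obtain ⟨R, hR⟩ := hK.exists_bound_of_continuousOn (f := fun u : ℂ => u) continuousOn_id
    exact ⟨max R 1, by positivity, fun u hu => (hR u hu).trans (le_max_left _ _)⟩
  obtain ⟨r, hr0, hr⟩ : ∃ r > 0, ∀ u ∈ K, ‖u‖⁻¹ ≤ r := by
    obtain ⟨R, hR⟩ := hK.exists_bound_of_continuousOn (f := fun u : ℂ => u⁻¹)
      (continuousOn_inv₀.mono hK0)
    refine ⟨max R 1, by positivity, fun u hu => ?_⟩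
    rw [← norm_inv]
    exact (hR u hu).trans (le_max_left _ _)
  -- `K` lies in the annulus `1 / r ≤ ‖u‖ ≤ R`; a factor `2` to spare on either side makes both
  -- tails geometric with ratio `1 / 2`.
  obtain ⟨M, hM0, hM⟩ := exists_coeff_bound h hf (r := 2 * R) (by positivity)
  obtain ⟨N, hN0, hN⟩ := exists_coeff_bound h hf (r := (2 * r)⁻¹) (by positivity)
  have hgeo : Summable fun n : ℕ => ((1 : ℝ) / 2) ^ n := summable_geometric_two
  refine ⟨fun m => (M * (2 * R)⁻¹ + N * (2 * r)) * (1 / 2) ^ m.natAbs, ?_, fun m u hu => ?_⟩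
  · refine Summable.mul_left _ (Summable.of_nat_of_neg_add_one (by simpa using hgeo) ?_)
    have := (summable_nat_add_iff 1).2 hgeo
    exact this.congr fun n => rfl
  · rw [norm_mul, norm_zpow]
    have hu0 : 0 < ‖u‖ := norm_pos_iff.2 (hK0 hu)
    rcases le_or_gt 0 m with hm | hm
    · lift m to ℕ using hm
      have h1 : ‖u‖ ^ (m : ℤ) ≤ R ^ m := by
        rw [zpow_natCast]
        exact pow_le_pow_left₀ hu0.le (hR u hu) m
      calc _ ≤ M * (2 * R) ^ (-(m : ℤ) - 1) * R ^ m :=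
            mul_le_mul (hM _) h1 (by positivity) (by positivity)
        _ = M * (2 * R)⁻¹ * (1 / 2) ^ m := by
            rw [zpow_sub_one₀ (by positivity), zpow_neg, zpow_natCast, mul_pow, one_div, inv_pow]
            field_simp
        _ ≤ _ := by
            simp only [Int.natAbs_natCast]
            have : 0 ≤ N * (2 * r) := by positivity
            gcongr
            linarith
    · obtain ⟨k, rfl⟩ : ∃ k : ℕ, m = -k := ⟨m.natAbs, by omega⟩
      have h1 : ‖u‖ ^ (-(k : ℤ)) ≤ r ^ k := by
        rw [zpow_neg, zpow_natCast, ← inv_pow]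
        exact pow_le_pow_left₀ (by positivity) (hr u hu) k
      calc _ ≤ N * (2 * r)⁻¹ ^ (- -(k : ℤ) - 1) * r ^ k :=
            mul_le_mul (hN _) h1 (by positivity) (by positivity)
        _ = N * (2 * r) * (1 / 2) ^ k := by
            rw [zpow_sub_one₀ (by positivity), neg_neg, zpow_natCast, inv_pow, mul_pow, one_div, inv_pow]
            field_simp
        _ ≤ _ := by
            simp only [Int.natAbs_neg, Int.natAbs_natCast]
            have : 0 ≤ M * (2 * R)⁻¹ := by positivity
            gcongr
            linarith

/-! ### Inversion -/

/-- The image of a loop under `z ↦ 1 / z`. -/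
def Loop.inv (γ : Loop) (h : γ.Avoids 0) : Loop where
  path s := (γ.path s)⁻¹
  continuousOn_path := γ.continuousOn_comp (f := fun z => z⁻¹) (continuousOn_inv₀.mono h.subset)
  closed := by rw [γ.closed]
  differentiable_off_corners := by
    obtain ⟨S, hS⟩ := γ.differentiable_off_corners
    exact ⟨S, fun s hs hs' => (hS s hs hs').inv (h s (Ioo_subset_Icc_self hs))⟩
  integrable_deriv := by
    have hc : ContinuousOn (fun z : ℂ => -(z ^ 2)⁻¹) γ.trace := fun z hz =>
      ((continuousAt_id.pow 2).inv₀ (pow_ne_zero 2 (h.ne hz))).neg.continuousWithinAt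
    refine (γ.intervalIntegrable hc).congr_ae ?_
    obtain ⟨S, hS⟩ := γ.differentiable_off_corners
    rw [Filter.EventuallyEq, ae_restrict_iff' measurableSet_uIoc]
    -- The corners and the endpoint `1`, where differentiability is not assumed, form a null set.
    filter_upwards [(insert 1 S).countable_toSet.ae_notMem volume] with s hs hs'
    rw [uIoc_of_le zero_le_one] at hs'
    rw [Finset.mem_coe, Finset.mem_insert, not_or] at hs
    have hs1 : s ∈ Ioo (0 : ℝ) 1 := ⟨hs'.1, lt_of_le_of_ne hs'.2 hs.1⟩
    rw [((hS s hs1 hs.2).hasDerivAt.fun_inv (h s (Ioo_subset_Icc_self hs1))).deriv]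
    ring

theorem Loop.integral_eq_neg_integral_inv (γ : Loop) (h : γ.Avoids 0) (f : ℂ → ℂ) :
    γ.integral f = -(γ.inv h).integral fun w => w ^ (-2 : ℤ) * f w⁻¹ := by
  obtain ⟨S, hS⟩ := γ.differentiable_off_corners
  rw [Loop.integral, Loop.integral, ← mul_neg, ← intervalIntegral.integral_neg]
  congr 1
  refine intervalIntegral.integral_congr_ae ?_
  filter_upwards [(insert 1 S).countable_toSet.ae_notMem volume] with s hs hs'
  rw [uIoc_of_le zero_le_one] at hs'
  rw [Finset.mem_coe, Finset.mem_insert, not_or] at hs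
  have hs1 : s ∈ Ioo (0 : ℝ) 1 := ⟨hs'.1, lt_of_le_of_ne hs'.2 hs.1⟩
  have h0 := h s (Ioo_subset_Icc_self hs1)
  simp only [Loop.inv]
  rw [((hS s hs1 hs.2).hasDerivAt.fun_inv h0).deriv, inv_inv, zpow_neg, inv_zpow, inv_inv]
  have : γ.path s ^ (2 : ℤ) = γ.path s ^ 2 := by norm_cast
  rw [this]
  field_simp

theorem Loop.inv_avoids_zero (γ : Loop) (h : γ.Avoids 0) : (γ.inv h).Avoids 0 :=
  fun s hs => inv_ne_zero (h s hs)

theorem Loop.inv_avoids_one (γ : Loop) (h : γ.Avoids 0) (h1 : γ.Avoids 1) :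
    (γ.inv h).Avoids 1 := fun s hs hs' => h1 s hs (inv_eq_one.1 hs')

theorem Loop.inv_winding_zero (γ : Loop) (h : γ.Avoids 0) :
    (γ.inv h).winding 0 = -γ.winding 0 := by
  rw [Loop.winding_zero, Loop.winding_zero, γ.integral_eq_neg_integral_inv h, neg_neg]
  refine Loop.integral_congr _ fun w hw => ?_
  have := (γ.inv_avoids_zero h).ne hw
  have h2 : w ^ (-2 : ℤ) = (w ^ 2)⁻¹ := by rw [zpow_neg]; norm_cast
  simp only [h2]
  field_simp

/-- Partial fractions: under `w = 1 / z` the form `dw / (w - 1)` becomes `dz / (z - 1) - dz / z`. -/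
theorem Loop.inv_winding_one (γ : Loop) (h : γ.Avoids 0) (h1 : γ.Avoids 1) :
    (γ.inv h).winding 1 = γ.winding 1 - γ.winding 0 := by
  have hi : ∀ p : ℂ, γ.Avoids p → ContinuousOn (fun z : ℂ => (z - p)⁻¹) γ.trace := fun p hp => by
    simpa only [zpow_neg_one] using (continuousOn_sub_zpow p (-1)).mono hp.subset
  simp only [Loop.winding]
  rw [← γ.integral_sub (hi 1 h1) (hi 0 h), γ.integral_eq_neg_integral_inv h,
    ← neg_one_mul, ← Loop.integral_const_mul]
  refine Loop.integral_congr _ fun w hw => ?_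
  have hw0 := (γ.inv_avoids_zero h).ne hw
  have hw1 : w - 1 ≠ 0 := sub_ne_zero.2 ((γ.inv_avoids_one h h1).ne hw)
  have h2 : w ^ (-2 : ℤ) = (w ^ 2)⁻¹ := by rw [zpow_neg]; norm_cast
  have h3 : w⁻¹ - 1 ≠ 0 := by
    rw [sub_ne_zero]
    intro h
    exact hw1 (by rw [inv_eq_one.1 h, sub_self])
  have h4 : 1 - w ≠ 0 := by rw [← neg_sub]; exact neg_ne_zero.2 hw1
  simp only [h2]
  have : w⁻¹ - 1 = (1 - w) / w := by field_simp
  rw [this, sub_zero, inv_inv, inv_div]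
  have : (1 - w) = -(w - 1) := by ring
  rw [this]
  field_simp
  ring

/-! ### Summation over `ℤ` and splitting of the contour. -/

/-- Termwise integration of a Laurent series in `1 / u` along a loop. -/
theorem hasSum_integral_laurent {γ γ' : Loop} (h : γ.Includes 0) (h' : γ'.Avoids 0)
    {f g : ℂ → ℂ} (hf : DifferentiableOn ℂ f {0}ᶜ) (hg : ContinuousOn g γ'.trace) :
    HasSum (fun x : ℤ => γ.integral (fun z => f z * z ^ (x - 1)) *
      γ'.integral fun u => u ^ x * g u) (γ'.integral fun u => f u⁻¹ * g u) := by
  obtain ⟨B, hB, hfB⟩ := exists_laurent_bound h hf (γ'.inv h').isCompact_trace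
    (γ'.inv_avoids_zero h').subset
  obtain ⟨M, hM⟩ := γ'.isCompact_trace.exists_bound_of_continuousOn hg
  have hinv : ∀ u ∈ γ'.trace, u⁻¹ ∈ (γ'.inv h').trace := by
    rintro _ ⟨s, hs, rfl⟩
    exact (γ'.inv h').path_mem_trace hs
  have e : ∀ (u : ℂ) (m : ℤ), γ.integral (fun z => f z * z ^ (-m - 1)) * u⁻¹ ^ m
      = γ.integral (fun z => f z * z ^ (-m - 1)) * u ^ (-m) := fun u m => by
    rw [inv_zpow']
  -- The Laurent index `m` is `-x`, since the series is evaluated at `1 / u`.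
  have key := (Equiv.neg ℤ).hasSum_iff.2 <| γ'.hasSum_integral (B := fun m => B m * M)
    (F := fun m u => γ.integral (fun z => f z * z ^ (-m - 1)) * (u ^ (-m) * g u))
    (f := fun u => f u⁻¹ * g u) (fun m => ?_) (fun m u hu => ?_)
    (hB.mul_right M) fun u hu => ?_
  · simpa only [Function.comp_def, Equiv.neg_apply, neg_neg, Loop.integral_const_mul] using key
  · exact continuousOn_const.mul
      (((differentiableOn_zpow_punctured _).continuousOn.mono h'.subset).mul hg)
  · rw [← mul_assoc, norm_mul, ← e]
    exact mul_le_mul (hfB m _ (hinv u hu)) (hM u hu) (norm_nonneg _)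
      ((norm_nonneg _).trans (hfB m _ (hinv u hu)))
  · simp_rw [← mul_assoc, ← e]
    exact (hasSum_laurent h hf (inv_ne_zero (h'.ne hu))).mul_right _

/-- In the coordinate `w = 1 / z`, a loop around `0` and not around `1` becomes a (clockwise)
loop around both points. -/
theorem integral_eq_add_of_inversion {C γ₀ γ₁ : Loop} (hC0 : C.Includes 0) (hC1 : C.Excludes 1)
    (h₀ : γ₀.Includes 0) (h₀₁ : γ₀.Excludes 1) (h₁ : γ₁.Includes 1) (h₁₀ : γ₁.Excludes 0)
    {f F : ℂ → ℂ} (hf : DifferentiableOn ℂ f {0}ᶜ) (m : ℤ)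
    (hF : ∀ w : ℂ, w ≠ 0 → w ≠ 1 → w ^ (-2 : ℤ) * F w⁻¹ = f w * (w - 1) ^ m) :
    C.integral F =
      γ₀.integral (fun w => f w * (w - 1) ^ m) + γ₁.integral fun w => f w * (w - 1) ^ m := by
  have ha0 := C.inv_avoids_zero hC0.1
  have ha1 := C.inv_avoids_one hC0.1 hC1.1
  -- The same `A` and `B` serve all three loops: the inverted one has winding numbers `-1` and `-1`,
  -- the other two `(1, 0)` and `(0, 1)`.
  obtain ⟨A, B, hAB⟩ := exists_integral_mul_zpow_eq hf one_ne_zero m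
  rw [C.integral_eq_neg_integral_inv hC0.1,
    (C.inv hC0.1).integral_congr fun w hw => hF w (ha0.ne hw) (ha1.ne hw),
    hAB _ ha0 ha1, hAB γ₀ h₀.1 h₀₁.1, hAB γ₁ h₁₀.1 h₁.1, C.inv_winding_zero,
    C.inv_winding_one hC0.1 hC1.1, hC0.2, hC1.2, h₀.2, h₀₁.2, h₁.2, h₁₀.2]
  ring

/-! ### Polynomial functions on `ℤ` -/

/-- The polynomial functions `ℤ → ℂ` of degree less than `d`. -/
def polyFun (d : ℕ) : Submodule ℂ (ℤ → ℂ) :=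
  Submodule.span ℂ (range fun (l : Fin d) (x : ℤ) => (x : ℂ) ^ (l : ℕ))

theorem pow_mem_polyFun {l d : ℕ} (h : l < d) : (fun x : ℤ => (x : ℂ) ^ l) ∈ polyFun d :=
  Submodule.subset_span ⟨⟨l, h⟩, rfl⟩

theorem polyFun_mono {d e : ℕ} (h : d ≤ e) : polyFun d ≤ polyFun e := by
  refine Submodule.span_le.2 ?_
  rintro _ ⟨l, rfl⟩
  exact pow_mem_polyFun (l.2.trans_le h)

theorem V_one (n : ℕ) : V (fun _ => 1) n = polyFun n := by
  refine le_antisymm (Submodule.span_le.2 ?_) (Submodule.span_le.2 ?_)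
  · rintro _ ⟨i, -, l, hl, rfl⟩
    simp only [Finset.filter_true, Nat.card_Icc, Nat.add_sub_cancel] at hl
    simpa using pow_mem_polyFun hl
  · rintro _ ⟨l, rfl⟩
    have hl := l.2
    exact Submodule.subset_span ⟨1, Finset.mem_Icc.2 ⟨le_rfl, by omega⟩, l, by simp, by simp⟩

/-- Discrete antiderivatives: the forward difference of `x ^ (d + 1)` is `(d + 1) * x ^ d` plus
terms of lower degree, which the induction hypothesis absorbs. -/
theorem exists_polyFun_forwardDiff_eq {d : ℕ} {g : ℤ → ℂ} (hg : g ∈ polyFun d) :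
    ∃ q ∈ polyFun (d + 1), ∀ x, q (x + 1) - q x = g x := by
  induction d generalizing g with
  | zero =>
    have : g = 0 := by simpa [polyFun] using hg
    exact ⟨0, zero_mem _, by simp [this]⟩
  | succ d ih =>
    have hlow : (fun x : ℤ => ((x + 1 : ℤ) : ℂ) ^ (d + 1) - (x : ℂ) ^ (d + 1)
        - (d + 1) * (x : ℂ) ^ d) ∈ polyFun d := by
      have e : (fun x : ℤ => ((x + 1 : ℤ) : ℂ) ^ (d + 1) - (x : ℂ) ^ (d + 1)
          - (d + 1) * (x : ℂ) ^ d)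
          = ∑ l ∈ Finset.range d, ((d + 1).choose l : ℂ) • fun x : ℤ => (x : ℂ) ^ l := by
        ext x
        push_cast
        rw [add_pow, Finset.sum_range_succ, Finset.sum_range_succ]
        simp [Finset.sum_apply, mul_comm]
      rw [e]
      exact Submodule.sum_mem _ fun l hl =>
        Submodule.smul_mem _ _ (pow_mem_polyFun (Finset.mem_range.1 hl))
    obtain ⟨r, hr, hr'⟩ := ih hlow
    have hd : (d + 1 : ℂ) ≠ 0 := by exact_mod_cast d.succ_ne_zero
    refine Submodule.span_induction (p := fun g _ => ∃ q ∈ polyFun (d + 1 + 1),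
      ∀ x, q (x + 1) - q x = g x) ?_ ?_ ?_ ?_ hg
    · rintro _ ⟨⟨l, hl⟩, rfl⟩
      rcases Nat.lt_succ_iff_lt_or_eq.1 hl with h | rfl
      · obtain ⟨q, hq, hq'⟩ := ih (pow_mem_polyFun h)
        exact ⟨q, polyFun_mono (Nat.le_succ _) hq, hq'⟩
      · refine ⟨(l + 1 : ℂ)⁻¹ • ((fun x : ℤ => (x : ℂ) ^ (l + 1)) - r),
          Submodule.smul_mem _ _ (Submodule.sub_mem _ (pow_mem_polyFun (Nat.lt_succ_self _))
            (polyFun_mono (Nat.le_succ _) hr)), fun x => ?_⟩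
        have := hr' x
        simp only [Pi.smul_apply, Pi.sub_apply, smul_eq_mul]
        rw [← mul_sub, inv_mul_eq_iff_eq_mul₀ hd]
        linear_combination -this
    · exact ⟨0, zero_mem _, by simp⟩
    · rintro g₁ g₂ - - ⟨q₁, h₁, h₁'⟩ ⟨q₂, h₂, h₂'⟩
      refine ⟨q₁ + q₂, add_mem h₁ h₂, fun x => ?_⟩
      simp only [Pi.add_apply]
      rw [← h₁' x, ← h₂' x]
      ring
    · rintro c g - ⟨q, h, h'⟩
      refine ⟨c • q, Submodule.smul_mem _ _ h, fun x => ?_⟩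
      simp only [Pi.smul_apply, smul_eq_mul]
      rw [← h' x]
      ring

/-- Functions on `ℤ` with equal forward differences differ by a constant. -/
theorem mem_polyFun_of_forwardDiff {d : ℕ} {f : ℤ → ℂ}
    (hf : (fun x => f (x + 1) - f x) ∈ polyFun d) : f ∈ polyFun (d + 1) := by
  obtain ⟨q, hq, hq'⟩ := exists_polyFun_forwardDiff_eq hf
  have hconst : ∀ x : ℤ, f x - q x = f 0 - q 0 := fun x => by
    induction x using Int.induction_on with
    | zero => rfl
    | succ i ih =>
      have := hq' i
      linear_combination ih - this
    | pred i ih =>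
      have := hq' (-i - 1)
      rw [sub_add_cancel] at this
      linear_combination ih + this
  have : f = q + (f 0 - q 0) • fun x : ℤ => (x : ℂ) ^ 0 := by
    ext x
    simp only [Pi.add_apply, Pi.smul_apply, pow_zero, smul_eq_mul, mul_one]
    linear_combination hconst x
  rw [this]
  exact add_mem hq (Submodule.smul_mem _ _ (pow_mem_polyFun (Nat.succ_pos _)))

/-- The residue at `1` of a function with a pole of order `d` times `z ^ x` is a polynomial in
`x` of degree less than `d`. -/
theorem integral_mem_polyFun {γ : Loop} (h0 : γ.Excludes 0) (h1 : γ.Avoids 1) {f : ℂ → ℂ}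
    (hf : DifferentiableOn ℂ f {0}ᶜ) (d : ℕ) :
    (fun x : ℤ => γ.integral fun z => z ^ x * (f z * (z - 1) ^ (-(d : ℤ)))) ∈ polyFun d := by
  induction d with
  | zero =>
    convert zero_mem (polyFun 0)
    rename_i x
    simp only [CharP.cast_eq_zero, neg_zero, zpow_zero, mul_one, Pi.zero_apply]
    exact Loop.integral_eq_zero_of_excludes h0 ((differentiableOn_zpow_punctured x).mul hf)
  | succ d ih =>
    -- A forward difference in `x` multiplies the integrand by `z - 1`, lowering the order of the
    -- pole by one.
    refine mem_polyFun_of_forwardDiff ?_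
    convert ih using 2 with x
    have hc : ∀ y : ℤ, ContinuousOn
        (fun z => z ^ y * (f z * (z - 1) ^ (-((d + 1 : ℕ) : ℤ)))) γ.trace := fun y =>
      ((differentiableOn_zpow_punctured y).continuousOn.mono h0.1.subset).mul
        ((hf.continuousOn.mono h0.1.subset).mul ((continuousOn_sub_zpow 1 _).mono h1.subset))
    rw [← γ.integral_sub (hc _) (hc _)]
    refine γ.integral_congr fun z hz => ?_
    have hz1 := sub_ne_zero.2 (h1.ne hz)
    have e : (z - 1) ^ (-(d : ℤ)) = (z - 1) * (z - 1) ^ (-((d + 1 : ℕ) : ℤ)) := by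
      rw [← zpow_one_add₀ hz1]
      congr 1
      push_cast
      ring
    simp only [e, zpow_add_one₀ (h0.1.ne hz)]
    ring

/-! ### The dual family -/

/-- The factor `e^{αz + β/z}`. -/
def expFactor (α β : ℂ) (z : ℂ) : ℂ := Complex.exp (α * z + β / z)

theorem differentiableOn_expFactor (α β : ℂ) : DifferentiableOn ℂ (expFactor α β) {0}ᶜ := by
  intro z hz
  have : DifferentiableAt ℂ (fun z => β / z) z :=
    (differentiableAt_const β).fun_div differentiableAt_id hz
  unfold expFactor
  exact ((differentiableAt_id.const_mul α).fun_add this).cexp.differentiableWithinAt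

theorem expFactor_mul (α β α' β' z : ℂ) :
    expFactor α β z * expFactor α' β' z = expFactor (α + α') (β + β') z := by
  simp only [expFactor, ← Complex.exp_add]
  congr 1
  ring

theorem expFactor_inv (α β z : ℂ) : expFactor α β z⁻¹ = expFactor β α z := by
  simp only [expFactor]
  congr 1
  rw [div_inv_eq_mul, ← div_eq_mul_inv]
  ring

theorem expFactor_zero (z : ℂ) : expFactor 0 0 z = 1 := by
  simp [expFactor]

/-- The function `Ψ` for unit rates and step initial condition. -/
theorem Psi_step {C : Loop} (hC : C.Avoids 1) (a b : ℝ → ℝ) (n : ℕ) (t : ℝ) (l : ℕ) (x : ℤ) :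
    Psi C a b (fun _ => 1) (fun k => -(k : ℤ)) n t (l + 1) x =
      C.integral fun z => z ^ (x + l) * expFactor (b t) (a t) z * (1 - z) ^ ((n : ℤ) - l - 1) := by
  refine C.integral_congr fun z hz => ?_
  have hz1 : 1 - z ≠ 0 := sub_ne_zero.2 (hC.ne hz).symm
  simp only [Complex.ofReal_one, one_mul, Finset.prod_const, Nat.card_Icc, Nat.add_sub_cancel,
    expFactor]
  have e : (n : ℤ) - l - 1 = n - ((l + 1 : ℕ) : ℤ) := by
    push_cast
    ring
  rw [e, zpow_sub₀ hz1, zpow_natCast, zpow_natCast, add_comm (_ / z)]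
  congr 3
  push_cast
  ring

/-- The dual functions for unit rates and step initial condition, as integrals around `1`. -/
def stepDual (γ : Loop) (a b : ℝ → ℝ) (n : ℕ) (t : ℝ) (k : Fin n) (x : ℤ) : ℂ :=
  γ.integral fun z => z ^ x * (z ^ n * expFactor (-a t) (-b t) z * (z - 1) ^ ((k : ℤ) - n))

theorem differentiableOn_pow_mul_expFactor (n : ℕ) (α β : ℂ) :
    DifferentiableOn ℂ (fun z => z ^ n * expFactor α β z) {0}ᶜ :=
  ((differentiable_id.pow n).differentiableOn).mul (differentiableOn_expFactor α β)

theorem stepDual_mem {γ : Loop} (h0 : γ.Excludes 0) (h1 : γ.Avoids 1) (a b : ℝ → ℝ) (n : ℕ)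
    (t : ℝ) (k : Fin n) : stepDual γ a b n t k ∈ polyFun n := by
  have h := integral_mem_polyFun h0 h1 (differentiableOn_pow_mul_expFactor n (-a t) (-b t)) (n - k)
  have e : -((n - k : ℕ) : ℤ) = (k : ℤ) - n := by
    have := k.2
    omega
  rw [e] at h
  exact polyFun_mono (Nat.sub_le _ _) h

/-- `l < n` keeps the generating function of `Ψ` free of a pole at `1`, so its Laurent series may be
summed at `1 / u` along `γ`. The exponentials cancel and the powers leave `(u - 1) ^ (k - l - 1)`.
-/
theorem hasSum_Psi_mul_stepDual {C γ : Loop} (hC0 : C.Includes 0) (hC1 : C.Excludes 1)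
    (h1 : γ.Includes 1) (h0 : γ.Avoids 0) (a b : ℝ → ℝ) (n : ℕ) (t : ℝ) (l k : Fin n) :
    HasSum (fun x : ℤ => Psi C a b (fun _ => 1) (fun k => -(k : ℤ)) n t (l + 1) x
      * stepDual γ a b n t k x) (if k = l then 1 else 0) := by
  have hl := l.2
  have hexp : (n : ℤ) - (l : ℕ) - 1 = ((n - l - 1 : ℕ) : ℤ) := by omega
  have hf : DifferentiableOn ℂ (fun z : ℂ => z ^ ((l : ℕ) + 1) * expFactor (b t) (a t) z
      * (1 - z) ^ (n - l - 1)) {0}ᶜ :=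
    (differentiableOn_pow_mul_expFactor _ _ _).mul
      (((differentiable_const 1).sub differentiable_id).pow _).differentiableOn
  have hg : ContinuousOn (fun z : ℂ => z ^ n * expFactor (-a t) (-b t) z
      * (z - 1) ^ (((k : ℕ) : ℤ) - n)) γ.trace :=
    ((differentiableOn_pow_mul_expFactor _ _ _).continuousOn.mono h0.subset).mul
      ((continuousOn_sub_zpow 1 _).mono h1.1.subset)
  convert hasSum_integral_laurent hC0 h0 hf hg using 1
  · ext x
    rw [Psi_step hC1.1, stepDual]
    congr 1
    refine C.integral_congr fun z hz => ?_
    have hz0 := hC0.1.ne hz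
    simp only [hexp, zpow_natCast, zpow_sub_one₀ hz0, zpow_add₀ hz0]
    field_simp
    ring
  · have e : γ.integral (fun z => (z - 1) ^ (((k : ℕ) : ℤ) - (l : ℕ) - 1))
        = if k = l then 1 else 0 := by
      split_ifs with hkl
      · subst hkl
        simp only [sub_self, zero_sub, zpow_neg_one]
        exact h1.2
      · refine γ.integral_zpow h1.1 fun h => hkl (Fin.ext ?_)
        omega
    rw [← e]
    refine γ.integral_congr fun z hz => ?_
    have hz0 := h0.ne hz
    have hz1 := sub_ne_zero.2 (h1.1.ne hz)
    have e1 : (1 - z⁻¹) = (z - 1) / z := by field_simp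
    have e2 : ((k : ℕ) : ℤ) - (l : ℕ) - 1 = ((n - l - 1 : ℕ) : ℤ) + (((k : ℕ) : ℤ) - n) := by
      omega
    have e3 : z ^ n = z ^ ((l : ℕ) + 1) * z ^ (n - l - 1) := by
      rw [← pow_add]
      congr 1
      omega
    have e4 : expFactor (a t) (b t) z * expFactor (-a t) (-b t) z = 1 := by
      rw [expFactor_mul, add_neg_cancel, add_neg_cancel, expFactor_zero]
    simp only [expFactor_inv, e1, e2, e3, zpow_add₀ hz1, zpow_natCast, div_pow, inv_pow]
    field_simp
    linear_combination -e4

/-- Pairing with `ψ l` reads off coefficients; this gives both linear independence and uniqueness.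
-/
theorem hasSum_sum_smul {n : ℕ} {ψ : Fin n → ℤ → ℂ} {Φ : Fin n → ℤ → ℂ}
    (h : ∀ l k, HasSum (fun x => ψ l x * Φ k x) (if k = l then 1 else 0)) (c : Fin n → ℂ)
    (l : Fin n) : HasSum (fun x => ψ l x * (∑ k, c k • Φ k) x) (c l) := by
  have := hasSum_sum (s := Finset.univ) fun k _ => (h l k).mul_left (c k)
  simp only [mul_ite, mul_one, mul_zero, Finset.sum_ite_eq', Finset.mem_univ, if_true] at this
  refine this.congr_fun fun x => ?_
  rw [Finset.sum_apply, Finset.mul_sum]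
  exact Finset.sum_congr rfl fun k _ => by
    simp only [Pi.smul_apply, smul_eq_mul]
    ring

/-- Existence of the dual family. -/
theorem isDualFamily_stepDual {C γ : Loop} (hC0 : C.Includes 0) (hC1 : C.Excludes 1)
    (h1 : γ.Includes 1) (h0 : γ.Excludes 0) (a b : ℝ → ℝ) (n : ℕ) (t : ℝ) :
    IsDualFamily C a b (fun _ => 1) (fun k => -(k : ℤ)) n t (stepDual γ a b n t) := by
  have hbi := hasSum_Psi_mul_stepDual hC0 hC1 h1 h0.1 a b n t
  refine ⟨hbi, ?_⟩
  have hli : LinearIndependent ℂ (stepDual γ a b n t) := by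
    rw [Fintype.linearIndependent_iff]
    intro c hc l
    have := hasSum_sum_smul (ψ := fun l x =>
      Psi C a b (fun _ => 1) (fun k => -(k : ℤ)) n t (l + 1) x) hbi c l
    simp only [hc, Pi.zero_apply, mul_zero] at this
    exact this.unique hasSum_zero
  rw [V_one]
  -- The `n` independent functions lie in a space spanned by `n` monomials, hence span it.
  have : FiniteDimensional ℂ (polyFun n) := FiniteDimensional.span_of_finite ℂ (finite_range _)
  refine Submodule.eq_of_le_of_finrank_le (Submodule.span_le.2 ?_) ?_
  · rintro _ ⟨k, rfl⟩
    exact stepDual_mem h0 h1.1 a b n t k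
  · rw [finrank_span_eq_card hli]
    exact finrank_range_le_card _

/-- Uniqueness of the dual family. -/
theorem IsDualFamily.unique {C : Loop} {a b : ℝ → ℝ} {v : ℕ → ℝ} {y : ℕ → ℤ} {n : ℕ} {t : ℝ}
    {Φ Φ' : Fin n → ℤ → ℂ} (h : IsDualFamily C a b v y n t Φ)
    (h' : IsDualFamily C a b v y n t Φ') : Φ' = Φ := by
  funext k
  have hk : Φ' k ∈ Submodule.span ℂ (range Φ) := by
    rw [h.2, ← h'.2]
    exact Submodule.subset_span ⟨k, rfl⟩
  obtain ⟨c, hc⟩ := (Submodule.mem_span_range_iff_exists_fun ℂ).1 hk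
  have hcl : ∀ l, c l = if k = l then 1 else 0 := fun l => by
    have := hasSum_sum_smul (ψ := fun l x => Psi C a b v y n t (l + 1) x) h.1 c l
    rw [hc] at this
    exact this.unique (h'.1 l k)
  rw [← hc]
  simp [hcl]

/-! ### Products of residues -/

theorem Loop.integral_mul_mul_zpow (γ : Loop) (h0 : γ.Avoids 0) {p : ℂ} (hp : p ≠ 0)
    (hγ : γ.Avoids p) {g h : ℂ → ℂ} (hg : DifferentiableOn ℂ g {0}ᶜ)
    (hh : DifferentiableOn ℂ h {0}ᶜ) (m : ℤ) :
    γ.integral (fun z => g z * h z * (z - p) ^ m) = h p * γ.integral (fun z => g z * (z - p) ^ m)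
      + γ.integral fun z => g z * dslope h p z * (z - p) ^ (m + 1) := by
  have hz : ∀ m, ContinuousOn (fun z : ℂ => (z - p) ^ (m : ℤ)) γ.trace := fun m =>
    (continuousOn_sub_zpow p m).mono hγ.subset
  have hgc := hg.continuousOn.mono h0.subset
  rw [← γ.integral_const_mul, ← γ.integral_add (continuousOn_const.fun_mul (hgc.fun_mul (hz _)))
    ((hgc.fun_mul ((differentiableOn_dslope_punctured hh hp).continuousOn.mono h0.subset)).fun_mul
      (hz _))]
  refine γ.integral_congr fun z hzt => ?_
  simp only [zpow_add_one₀ (sub_ne_zero.2 (hγ.ne hzt))]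
  rw [eq_add_mul_dslope h p z]
  ring

/-- The residue at `1` of a product, in terms of the Laurent coefficients of the factors. -/
theorem sum_integral_mul_integral {γ : Loop} (h0 : γ.Excludes 0) (h1 : γ.Includes 1)
    {g h : ℂ → ℂ} (hg : DifferentiableOn ℂ g {0}ᶜ) (hh : DifferentiableOn ℂ h {0}ᶜ) (M N : ℕ) :
    ∑ k ∈ Finset.range N, γ.integral (fun z => g z * (z - 1) ^ ((M : ℤ) - k - 1))
        * γ.integral (fun z => h z * (z - 1) ^ ((k : ℤ) - N))
      = γ.integral fun z => g z * h z * (z - 1) ^ ((M : ℤ) - N) := by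
  induction N generalizing h with
  | zero =>
    rw [Finset.sum_range_zero, eq_comm]
    exact Loop.integral_eq_zero_of_excludes h0
      (differentiableOn_mul_sub_zpow (hg.mul hh) 1 (by simp))
  | succ N ih =>
    -- Passing from `h` to `dslope h 1` shifts Taylor coefficients at `1`: only the term `k = N`
    -- sees `h 1`, and the others are the sum for `dslope h 1` and `N`.
    have hsplit : ∀ m : ℤ, γ.integral (fun z => h z * (z - 1) ^ m)
        = h 1 * γ.integral (fun z => (z - 1) ^ m)
          + γ.integral fun z => dslope h 1 z * (z - 1) ^ (m + 1) := fun m => by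
      simpa only [one_mul] using γ.integral_mul_mul_zpow h0.1 one_ne_zero h1.1
        (differentiableOn_const 1) hh m
    have hd := differentiableOn_dslope_punctured hh one_ne_zero
    rw [Finset.sum_range_succ, γ.integral_mul_mul_zpow h0.1 one_ne_zero h1.1 hg hh]
    have hlast : γ.integral (fun z => h z * (z - 1) ^ ((N : ℤ) - (N + 1 : ℕ))) = h 1 := by
      have e : (N : ℤ) - (N + 1 : ℕ) = -1 := by
        push_cast
        ring
      have h2 : γ.integral (fun z => (z - 1)⁻¹) = 1 := h1.2
      rw [e, hsplit]
      simp only [zpow_neg_one, h2, neg_add_cancel, zpow_zero, mul_one]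
      rw [Loop.integral_eq_zero_of_excludes h0 hd, add_zero]
    have hfirst : ∀ k ∈ Finset.range N, γ.integral (fun z => g z * (z - 1) ^ ((M : ℤ) - k - 1))
        * γ.integral (fun z => h z * (z - 1) ^ ((k : ℤ) - (N + 1 : ℕ)))
        = γ.integral (fun z => g z * (z - 1) ^ ((M : ℤ) - k - 1))
          * γ.integral (fun z => dslope h 1 z * (z - 1) ^ ((k : ℤ) - N)) := fun k hk => by
      have hk' := Finset.mem_range.1 hk
      rw [hsplit, γ.integral_zpow h1.1 (by push_cast; omega), mul_zero, zero_add]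
      congr 3
      ext z
      congr 2
      push_cast
      ring
    rw [hlast, Finset.sum_congr rfl hfirst, ih hd, add_comm, mul_comm (γ.integral _) (h 1),
      show (M : ℤ) - (N + 1 : ℕ) + 1 = M - N by push_cast; ring,
      show (M : ℤ) - (N + 1 : ℕ) = M - N - 1 by push_cast; ring]

/-- A finite geometric sum, used with `W = w - 1` and `Z = z - 1` to separate the variables in `1 /
(w - z)`. -/
theorem zpow_neg_div_sub {W Z : ℂ} (hW : W ≠ 0) (hZ : Z ≠ 0) (h : W - Z ≠ 0) (N : ℕ) :
    Z ^ (-(N : ℤ)) * (W - Z)⁻¹ = W ^ (-(N : ℤ)) * (W - Z)⁻¹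
      + ∑ k ∈ Finset.range N, W ^ (-(k : ℤ) - 1) * Z ^ ((k : ℤ) - N) := by
  induction N with
  | zero => simp
  | succ N ih =>
    have e : ∀ k ∈ Finset.range N, W ^ (-(k : ℤ) - 1) * Z ^ ((k : ℤ) - (N + 1 : ℕ))
        = W ^ (-(k : ℤ) - 1) * Z ^ ((k : ℤ) - N) * Z⁻¹ := fun k _ => by
      rw [mul_assoc, ← zpow_sub_one₀ hZ]
      congr 2
      push_cast
      ring
    have e1 : ∀ {X : ℂ}, X ≠ 0 → X ^ (-((N + 1 : ℕ) : ℤ)) = X ^ (-(N : ℤ)) * X⁻¹ := fun hX => by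
      rw [← zpow_sub_one₀ hX]
      congr 1
      push_cast
      ring
    have e2 : (N : ℤ) - (N + 1 : ℕ) = -1 := by
      push_cast
      ring
    rw [Finset.sum_range_succ, Finset.sum_congr rfl e, ← Finset.sum_mul, e1 hZ, e1 hW, e2,
      zpow_neg_one, zpow_sub_one₀ hW]
    have e3 : W ^ (-(N : ℤ)) * W⁻¹ * (W - Z)⁻¹ + W ^ (-(N : ℤ)) * W⁻¹ * Z⁻¹
        = W ^ (-(N : ℤ)) * (W - Z)⁻¹ * Z⁻¹ := by
      field_simp
      ring
    linear_combination Z⁻¹ * ih - e3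

/-- A Cauchy integral around `1` at a point outside the loop is a polynomial in `1 / (w - 1)`. -/
theorem integral_zpow_div_sub {γ : Loop} (h0 : γ.Excludes 0) (h1 : γ.Avoids 1) {h : ℂ → ℂ}
    (hh : DifferentiableOn ℂ h {0}ᶜ) {w : ℂ} (hw0 : w ≠ 0) (hw1 : w ≠ 1) (hw : γ.Excludes w)
    (N : ℕ) :
    γ.integral (fun z => h z * (z - 1) ^ (-(N : ℤ)) * (w - z)⁻¹)
      = ∑ k ∈ Finset.range N, (w - 1) ^ (-(k : ℤ) - 1)
          * γ.integral (fun z => h z * (z - 1) ^ ((k : ℤ) - N)) := by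
  have hhc := hh.continuousOn.mono h0.1.subset
  have hi : ContinuousOn (fun z : ℂ => (z - w)⁻¹) γ.trace := by
    simpa only [zpow_neg_one] using (continuousOn_sub_zpow w (-1)).mono hw.1.subset
  have hz : ∀ m, ContinuousOn (fun z : ℂ => (z - 1) ^ (m : ℤ)) γ.trace := fun m =>
    (continuousOn_sub_zpow 1 m).mono h1.subset
  -- The boundary term of the geometric sum has no pole at `1`, and the loop winds around neither
  -- `0` nor `w`.
  have hvanish : γ.integral (fun z => h z * (z - w)⁻¹) = 0 := by
    rw [γ.integral_mul_sub_inv hh hw0 h0.1 hw.1, hw.2, mul_zero, zero_add,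
      Loop.integral_eq_zero_of_excludes h0 (differentiableOn_dslope_punctured hh hw0)]
  simp_rw [← Loop.integral_const_mul]
  rw [← γ.integral_finsetSum _ fun k _ => continuousOn_const.fun_mul (hhc.fun_mul (hz _))]
  have key : γ.integral (fun z => h z * (z - 1) ^ (-(N : ℤ)) * (w - z)⁻¹)
      = γ.integral fun z => -(w - 1) ^ (-(N : ℤ)) * (h z * (z - w)⁻¹)
        + ∑ k ∈ Finset.range N, (w - 1) ^ (-(k : ℤ) - 1) * (h z * (z - 1) ^ ((k : ℤ) - N)) := by
    refine γ.integral_congr fun z hzt => ?_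
    have hwz : w - 1 - (z - 1) ≠ 0 := by
      rw [sub_sub_sub_cancel_right, sub_ne_zero]
      exact (hw.1.ne hzt).symm
    have hid := zpow_neg_div_sub (sub_ne_zero.2 hw1) (sub_ne_zero.2 (h1.ne hzt)) hwz N
    rw [sub_sub_sub_cancel_right] at hid
    rw [mul_assoc, hid, mul_add, Finset.mul_sum, ← neg_sub w z, inv_neg]
    congr 1
    · ring
    · exact Finset.sum_congr rfl fun k _ => by ring
  rw [key, γ.integral_add (continuousOn_const.fun_mul (hhc.fun_mul hi))
    (continuousOn_finsetSum _ fun k _ => continuousOn_const.fun_mul (hhc.fun_mul (hz _))),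
    γ.integral_const_mul, hvanish, mul_zero, zero_add]

/-! ### The kernel -/

/-- The factor of the integrand in the variable `w`. -/
def wFactor (n : ℕ) (α β : ℂ) (x : ℤ) (w : ℂ) : ℂ := w ^ (-x - n - 1) * expFactor α β w

/-- The factor of the integrand in the variable `z`. -/
def zFactor (n : ℕ) (α β : ℂ) (x : ℤ) (z : ℂ) : ℂ := z ^ (x + n) * expFactor (-α) (-β) z

theorem differentiableOn_wFactor (n : ℕ) (α β : ℂ) (x : ℤ) :
    DifferentiableOn ℂ (wFactor n α β x) {0}ᶜ :=
  (differentiableOn_zpow_punctured _).mul (differentiableOn_expFactor _ _)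

theorem differentiableOn_zFactor (n : ℕ) (α β : ℂ) (x : ℤ) :
    DifferentiableOn ℂ (zFactor n α β x) {0}ᶜ :=
  (differentiableOn_zpow_punctured _).mul (differentiableOn_expFactor _ _)

theorem wFactor_mul_zFactor {w : ℂ} (hw : w ≠ 0) (n₁ n₂ : ℕ) (α₁ β₁ α₂ β₂ : ℂ) (x₁ x₂ : ℤ) :
    wFactor n₁ α₁ β₁ x₁ w * zFactor n₂ α₂ β₂ x₂ w
      = w ^ (x₂ - x₁ - 1 + (n₂ - n₁)) * expFactor (α₁ - α₂) (β₁ - β₂) w := by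
  rw [wFactor, zFactor, mul_mul_mul_comm, expFactor_mul, ← zpow_add₀ hw, sub_eq_add_neg α₁,
    sub_eq_add_neg β₁]
  congr 2
  ring

theorem stepDual_eq {γ : Loop} (h0 : γ.Avoids 0) (a b : ℝ → ℝ) (n : ℕ) (t : ℝ) (k : Fin n)
    (x : ℤ) : stepDual γ a b n t k x =
      γ.integral fun z => zFactor n (a t) (b t) x z * (z - 1) ^ (((k : ℕ) : ℤ) - n) := by
  refine γ.integral_congr fun z hz => ?_
  simp only [zFactor, zpow_add₀ (h0.ne hz), zpow_natCast]
  ring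

theorem one_sub_inv_zpow {w : ℂ} (hw : w ≠ 0) (m : ℤ) :
    (1 - w⁻¹) ^ m = (w - 1) ^ m * w ^ (-m) := by
  have : 1 - w⁻¹ = (w - 1) * w⁻¹ := by field_simp
  rw [this, mul_zpow, inv_zpow']

theorem neg_one_zpow_sub_natCast (m n : ℕ) :
    (-1 : ℂ) ^ ((m : ℤ) - n) = (-1) ^ m * (-1) ^ n := by
  rw [zpow_sub₀ (by norm_num), zpow_natCast, zpow_natCast, div_eq_mul_inv]
  congr 1
  rw [← inv_pow]
  norm_num

/-- Here `l ≥ n` is allowed, as the kernel requires when `n₁ < n₂`; then the integrand has a pole at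
`1` and the second integral matters. -/
theorem Psi_step_eq_add {C γ₀ γ₁ : Loop} (hC0 : C.Includes 0) (hC1 : C.Excludes 1)
    (h₀ : γ₀.Includes 0) (h₀₁ : γ₀.Excludes 1)
    (h₁ : γ₁.Includes 1) (h₁₀ : γ₁.Excludes 0)
    (a b : ℝ → ℝ) (n : ℕ) (t : ℝ) (l : ℕ) (x : ℤ) :
    Psi C a b (fun _ => 1) (fun k => -(k : ℤ)) n t (l + 1) x =
      γ₀.integral (fun w => wFactor n (a t) (b t) x w * (w - 1) ^ ((n : ℤ) - l - 1))
      + γ₁.integral fun w => wFactor n (a t) (b t) x w * (w - 1) ^ ((n : ℤ) - l - 1) := by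
  rw [Psi_step hC1.1]
  refine integral_eq_add_of_inversion hC0 hC1 h₀ h₀₁ h₁ h₁₀ (differentiableOn_wFactor _ _ _ _) _
    fun w hw _ => ?_
  rw [expFactor_inv, one_sub_inv_zpow hw, inv_zpow', wFactor]
  have e : w ^ (-x - n - 1) = w ^ (-2 : ℤ) * w ^ (-(x + l)) * w ^ (-((n : ℤ) - l - 1)) := by
    rw [← zpow_add₀ hw, ← zpow_add₀ hw]
    congr 1
    ring
  rw [e]
  ring

/-- The part around `0` is the single integral of the explicit kernel up to sign; the part around
`1` is there to be cancelled. -/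
theorem phi_step_eq_add {C γ₀ γ₁ : Loop} (hC0 : C.Includes 0) (hC1 : C.Excludes 1)
    (h₀ : γ₀.Includes 0) (h₀₁ : γ₀.Excludes 1)
    (h₁ : γ₁.Includes 1) (h₁₀ : γ₁.Excludes 0)
    (a b : ℝ → ℝ) {p₁ p₂ : ℕ × ℝ} (hp : Prec p₁ p₂) (x₁ x₂ : ℤ) :
    phi C a b (fun _ => 1) p₁ x₁ p₂ x₂ =
      γ₀.integral (fun w => wFactor p₁.1 (a p₁.2) (b p₁.2) x₁ w
        * zFactor p₂.1 (a p₂.2) (b p₂.2) x₂ w * (w - 1) ^ ((p₁.1 : ℤ) - p₂.1))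
      + γ₁.integral (fun w => wFactor p₁.1 (a p₁.2) (b p₁.2) x₁ w
        * zFactor p₂.1 (a p₂.2) (b p₂.2) x₂ w * (w - 1) ^ ((p₁.1 : ℤ) - p₂.1)) := by
  rw [phi, if_pos hp]
  refine integral_eq_add_of_inversion hC0 hC1 h₀ h₀₁ h₁ h₁₀
    ((differentiableOn_wFactor _ _ _ _).mul (differentiableOn_zFactor _ _ _ _)) _
    fun w hw hw1 => ?_
  have hcard : (((Finset.Icc (p₁.1 + 1) p₂.1).card : ℕ) : ℤ) = (p₂.1 : ℤ) - p₁.1 := by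
    rw [Nat.card_Icc]
    have := hp.1
    omega
  rw [Pi.mul_apply, wFactor_mul_zFactor hw]
  simp only [Complex.ofReal_one, one_mul, Finset.prod_const]
  rw [← zpow_natCast, hcard, one_sub_inv_zpow hw, ← Complex.exp_add,
    show (p₁.1 : ℤ) - p₂.1 = -((p₂.1 : ℤ) - p₁.1) by ring, zpow_neg (w - 1), inv_zpow',
    zpow_add₀ hw, show x₂ - x₁ - 1 = (-2 : ℤ) + (x₂ - x₁ + 1) by ring, zpow_add₀ hw,
    zpow_neg w (x₂ - x₁ + 1), zpow_neg w ((p₂.1 : ℤ) - p₁.1), expFactor, div_inv_eq_mul,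
    ← div_eq_mul_inv (_ - _) w]
  have hw1' := zpow_ne_zero ((p₂.1 : ℤ) - p₁.1) (sub_ne_zero.2 hw1)
  field_simp

/-- For `w` on `γ₀`, `integral_zpow_div_sub` turns the inner integral into a finite sum whose
coefficients are the dual functions. -/
theorem stepKernel_double_integral {γ₀ γ₁ : Loop} (h₀ : γ₀.Includes 0) (h₀₁ : γ₀.Excludes 1)
    (h₁ : γ₁.Includes 1) (h₁₀ : γ₁.Excludes 0) (a b : ℝ → ℝ)
    (h₀z : ∀ s ∈ Icc (0 : ℝ) 1, γ₁.Excludes (γ₀.path s))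
    (p₁ p₂ : ℕ × ℝ) (x₁ x₂ : ℤ) :
    (γ₀.integral fun w => γ₁.integral fun z =>
      Complex.exp (b p₁.2 / w + a p₁.2 * w) / Complex.exp (b p₂.2 / z + a p₂.2 * z)
        * ((1 - w) ^ p₁.1 / w ^ (x₁ + p₁.1 + 1))
        * (z ^ (x₂ + p₂.1) / (1 - z) ^ p₂.1)
        * (1 / (w - z))) = (-1) ^ ((p₁.1 : ℤ) - p₂.1) * ∑ k : Fin p₂.1,
      γ₀.integral (fun w => wFactor p₁.1 (a p₁.2) (b p₁.2) x₁ w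
          * (w - 1) ^ ((p₁.1 : ℤ) - (k : ℕ) - 1))
        * stepDual γ₁ a b p₂.1 p₂.2 k x₂ := by
  have hinner : ∀ w ∈ γ₀.trace, (γ₁.integral fun z =>
      Complex.exp (b p₁.2 / w + a p₁.2 * w) / Complex.exp (b p₂.2 / z + a p₂.2 * z)
        * ((1 - w) ^ p₁.1 / w ^ (x₁ + p₁.1 + 1))
        * (z ^ (x₂ + p₂.1) / (1 - z) ^ p₂.1)
        * (1 / (w - z))) = (-1) ^ ((p₁.1 : ℤ) - p₂.1) * ∑ k : Fin p₂.1,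
      wFactor p₁.1 (a p₁.2) (b p₁.2) x₁ w * (w - 1) ^ ((p₁.1 : ℤ) - (k : ℕ) - 1)
        * stepDual γ₁ a b p₂.1 p₂.2 k x₂ := by
    intro w hw
    have hw0 := h₀.1.ne hw
    have hw1 := h₀₁.1.ne hw
    have hwe : γ₁.Excludes w := by
      obtain ⟨s, hs, rfl⟩ := hw
      exact h₀z s hs
    have key := integral_zpow_div_sub h₁₀ h₁.1
      (differentiableOn_zFactor p₂.1 (a p₂.2) (b p₂.2) x₂) hw0 hw1 hwe p₂.1
    rw [← Fin.sum_univ_eq_sum_range (fun k => (w - 1) ^ (-(k : ℤ) - 1)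
      * γ₁.integral (fun z => zFactor p₂.1 (a p₂.2) (b p₂.2) x₂ z
        * (z - 1) ^ ((k : ℤ) - p₂.1)))] at key
    trans ((-1) ^ ((p₁.1 : ℤ) - p₂.1) * (wFactor p₁.1 (a p₁.2) (b p₁.2) x₁ w * (w - 1) ^ p₁.1))
      * γ₁.integral (fun z => zFactor p₂.1 (a p₂.2) (b p₂.2) x₂ z * (z - 1) ^ (-(p₂.1 : ℤ))
        * (w - z)⁻¹)
    · rw [← γ₁.integral_const_mul]
      refine γ₁.integral_congr fun z _ => ?_
      have e1 : (1 - w) ^ p₁.1 = (-1) ^ p₁.1 * (w - 1) ^ p₁.1 := by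
        rw [← mul_pow]
        congr 1
        ring
      have e2 : ((1 - z) ^ p₂.1)⁻¹ = (-1) ^ p₂.1 * ((z - 1) ^ p₂.1)⁻¹ := by
        rw [← inv_pow, ← inv_pow, ← mul_pow, ← neg_sub z 1, inv_neg]
        congr 1
        ring
      have e3 : (Complex.exp (b p₂.2 / z + a p₂.2 * z))⁻¹
          = expFactor (-a p₂.2) (-b p₂.2) z := by
        rw [← Complex.exp_neg, expFactor]
        congr 1
        ring
      have e4 : Complex.exp (b p₁.2 / w + a p₁.2 * w) = expFactor (a p₁.2) (b p₁.2) w := by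
        rw [expFactor, add_comm]
      have e5 : w ^ (-x₁ - p₁.1 - 1) = (w ^ (x₁ + p₁.1 + 1))⁻¹ := by
        rw [← zpow_neg]
        congr 1
        ring
      rw [div_eq_mul_inv (Complex.exp _), e3, e4, div_eq_mul_inv _ ((1 - z) ^ p₂.1), e2, e1,
        neg_one_zpow_sub_natCast, zFactor, wFactor, e5, zpow_neg, zpow_natCast]
      ring
    · rw [key, mul_assoc, Finset.mul_sum]
      congr 1
      refine Finset.sum_congr rfl fun k _ => ?_
      rw [stepDual_eq h₁₀.1, show (p₁.1 : ℤ) - (k : ℕ) - 1 = p₁.1 + (-((k : ℕ) : ℤ) - 1) by ring,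
        zpow_add₀ (sub_ne_zero.2 hw1), zpow_natCast]
      ring
  rw [γ₀.integral_congr hinner, γ₀.integral_const_mul, γ₀.integral_finsetSum]
  · simp_rw [γ₀.integral_mul_const]
  · exact fun k _ => (((differentiableOn_wFactor _ _ _ _).continuousOn.mono h₀.1.subset).mul
      ((continuousOn_sub_zpow 1 _).mono h₀₁.1.subset)).mul continuousOn_const

/-- `Γ` and `γ₀` have the same winding numbers around `0` and `1`, hence give the same integral. -/
theorem stepKernel_single_integral {Γ γ₀ : Loop} (h₀ : γ₀.Includes 0) (h₀₁ : γ₀.Excludes 1)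
    (a b : ℝ → ℝ) (hΓ0 : Γ.Includes 0) (hΓ1 : Γ.Excludes 1)
    (p₁ p₂ : ℕ × ℝ) (x₁ x₂ : ℤ) :
    (Γ.integral fun w =>
        1 / w ^ (x₁ - x₂ + 1) * (w / (1 - w)) ^ ((p₂.1 : ℤ) - p₁.1)
          * (Complex.exp (a p₁.2 * w + b p₁.2 / w) / Complex.exp (a p₂.2 * w + b p₂.2 / w)))
      = (-1) ^ ((p₁.1 : ℤ) - p₂.1) * γ₀.integral (fun w => wFactor p₁.1 (a p₁.2) (b p₁.2) x₁ w
        * zFactor p₂.1 (a p₂.2) (b p₂.2) x₂ w * (w - 1) ^ ((p₁.1 : ℤ) - p₂.1)) := by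
  obtain ⟨A, B, hAB⟩ := exists_integral_mul_zpow_eq ((differentiableOn_wFactor p₁.1 (a p₁.2)
    (b p₁.2) x₁).mul (differentiableOn_zFactor p₂.1 (a p₂.2) (b p₂.2) x₂)) one_ne_zero
    ((p₁.1 : ℤ) - p₂.1)
  have h := hAB γ₀ h₀.1 h₀₁.1
  have hΓ := hAB Γ hΓ0.1 hΓ1.1
  rw [h₀.2, h₀₁.2] at h
  rw [hΓ0.2, hΓ1.2, ← h] at hΓ
  simp only [Pi.mul_apply] at hΓ
  rw [← hΓ, ← Γ.integral_const_mul]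
  refine Γ.integral_congr fun w hw => ?_
  have hw0 := hΓ0.1.ne hw
  have e : w / (1 - w) = -1 * (w * (w - 1)⁻¹) := by
    rw [← neg_sub w 1, div_neg, neg_one_mul, div_eq_mul_inv]
  have e1 : (-1 : ℂ) ^ ((p₂.1 : ℤ) - p₁.1) = (-1) ^ ((p₁.1 : ℤ) - p₂.1) := by
    rw [neg_one_zpow_sub_natCast, neg_one_zpow_sub_natCast, mul_comm]
  simp only [wFactor_mul_zFactor hw0]
  rw [e, mul_zpow, mul_zpow, e1, inv_zpow', neg_sub, ← Complex.exp_sub,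
    show x₂ - x₁ - 1 = -(x₁ - x₂ + 1) by ring, zpow_add₀ hw0 (-(x₁ - x₂ + 1)), zpow_neg w (x₁ - x₂ + 1), expFactor, one_div]
  have e2 : (a p₁.2 * w + b p₁.2 / w - (a p₂.2 * w + b p₂.2 / w) : ℂ)
      = (a p₁.2 - a p₂.2) * w + (b p₁.2 - b p₂.2) / w := by ring
  rw [e2]
  ring

/-- The explicit kernel is a conjugation of the kernel of PushASEP. -/
theorem stepKernel_eq_mul_kernel {C γ₀ γ₁ : Loop} (hC0 : C.Includes 0) (hC1 : C.Excludes 1)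
    (h₀ : γ₀.Includes 0) (h₀₁ : γ₀.Excludes 1)
    (h₁ : γ₁.Includes 1) (h₁₀ : γ₁.Excludes 0)
    (a b : ℝ → ℝ)
    {Γ : Loop} (hΓ0 : Γ.Includes 0) (hΓ1 : Γ.Excludes 1)
    (h₀z : ∀ s ∈ Icc (0 : ℝ) 1, γ₁.Excludes (γ₀.path s)) {p₁ p₂ : ℕ × ℝ}
    (hp : Prec p₁ p₂ ∨ p₂.1 ≤ p₁.1) (x₁ x₂ : ℤ) :
    stepKernel Γ γ₀ γ₁ a b p₁ x₁ p₂ x₂ = (-1 : ℂ) ^ ((p₁.1 : ℤ) - p₂.1)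
      * kernel C a b (fun _ => 1) (fun k => -(k : ℤ)) (stepDual γ₁ a b) p₁ x₁ p₂ x₂ := by
  -- The parts around `1` sum to exactly the part of `φ` around `1`.
  have hsum : ∑ k : Fin p₂.1, γ₁.integral (fun w => wFactor p₁.1 (a p₁.2) (b p₁.2) x₁ w
        * (w - 1) ^ ((p₁.1 : ℤ) - (k : ℕ) - 1)) * stepDual γ₁ a b p₂.1 p₂.2 k x₂
      = γ₁.integral fun w => wFactor p₁.1 (a p₁.2) (b p₁.2) x₁ w
        * zFactor p₂.1 (a p₂.2) (b p₂.2) x₂ w * (w - 1) ^ ((p₁.1 : ℤ) - p₂.1) := by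
    rw [← sum_integral_mul_integral h₁₀ h₁ (differentiableOn_wFactor _ _ _ _)
      (differentiableOn_zFactor _ _ _ _), ← Fin.sum_univ_eq_sum_range (fun k =>
        γ₁.integral (fun z => wFactor p₁.1 (a p₁.2) (b p₁.2) x₁ z
          * (z - 1) ^ ((p₁.1 : ℤ) - k - 1))
        * γ₁.integral (fun z => zFactor p₂.1 (a p₂.2) (b p₂.2) x₂ z
          * (z - 1) ^ ((k : ℤ) - p₂.1)))]
    simp_rw [stepDual_eq h₁₀.1]
  rw [stepKernel, kernel, stepKernel_double_integral h₀ h₀₁ h₁ h₁₀ a b h₀z,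
    stepKernel_single_integral h₀ h₀₁ a b hΓ0 hΓ1]
  simp_rw [Psi_step_eq_add hC0 hC1 h₀ h₀₁ h₁ h₁₀, add_mul, Finset.sum_add_distrib]
  rw [hsum]
  by_cases h : Prec p₁ p₂
  · rw [if_pos h, phi_step_eq_add hC0 hC1 h₀ h₀₁ h₁ h₁₀ a b h]
    ring
  -- There is no `φ` to cancel against, but `n₂ ≤ n₁` removes the pole at `1`, so the residue is
  -- zero.
  · have hle : (0 : ℤ) ≤ (p₁.1 : ℤ) - p₂.1 := by
      have := hp.resolve_left h
      omega
    have hvanish := Loop.integral_eq_zero_of_excludes h₁₀ (differentiableOn_mul_sub_zpow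
      ((differentiableOn_wFactor p₁.1 (a p₁.2) (b p₁.2) x₁).mul
        (differentiableOn_zFactor p₂.1 (a p₂.2) (b p₂.2) x₂)) 1 hle)
    simp only [Pi.mul_apply] at hvanish
    rw [if_neg h, phi, if_neg h, hvanish]
    ring

/-- The sign factors as `(-1) ^ n α * (-1) ^ n β`, and in the determinant each `(-1) ^ n α` appears
squared. -/
theorem det_conj_neg_one {r : ℕ} (n : Fin r → ℕ) (M : Matrix (Fin r) (Fin r) ℂ) :
    (Matrix.of fun α β => (-1 : ℂ) ^ ((n α : ℤ) - n β) * M α β).det = M.det := by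
  have hM : (Matrix.of fun α β => (-1 : ℂ) ^ ((n α : ℤ) - n β) * M α β)
      = Matrix.diagonal (fun α => (-1) ^ n α) * M * Matrix.diagonal fun β => (-1) ^ n β := by
    ext α β
    simp only [Matrix.of_apply, neg_one_zpow_sub_natCast, Matrix.mul_diagonal,
      Matrix.diagonal_mul]
    ring
  rw [hM, Matrix.det_mul, Matrix.det_mul, mul_right_comm, Matrix.det_diagonal,
    ← Finset.prod_mul_distrib]
  simp [← mul_pow]

/-- The only consequence of space-likeness that the kernel identity needs: either `φ` is present or
there is no pole at `1`. -/
theorem IsSpaceLike.prec_or_le {m : ℕ} {p : Fin m → ℕ × ℝ} (hp : IsSpaceLike p) (i j : Fin m) :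
    Prec (p i) (p j) ∨ (p j).1 ≤ (p i).1 := by
  rcases lt_trichotomy i j with h | rfl | h
  · exact Or.inl (hp i j h)
  · exact Or.inr le_rfl
  · exact Or.inr (hp j i h).1

end PushASEP

end

/-- Uniform rates `v_k = 1` and step initial condition `y_k = -k`. The functions `Φ` entering the
PushASEP kernel exist and are unique, and along every space-like path the kernel is the explicit
one, up to the conjugation by `(-1)^{n₁-n₂}`, which leaves all correlation determinants
unchanged. -/
theorem proposition3p3 (a b : ℝ → ℝ)
    -- contour used in the definition of the general kernel: around 0, pole 1 / v_j = 1 outside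
    (C : PushASEP.Loop) (hC0 : C.Includes 0) (hC1 : C.Excludes 1)
    -- contour of the single integral
    (Γ : PushASEP.Loop) (hΓ0 : Γ.Includes 0) (hΓ1 : Γ.Excludes 1)
    -- contours of the double integral
    (Γ₀ Γ₁ : PushASEP.Loop)
    (h₀ : Γ₀.Includes 0) (h₀₁ : Γ₀.Excludes 1)
    (h₀z : ∀ s ∈ Set.Icc (0 : ℝ) 1, Γ₀.Excludes (Γ₁.path s))
    (h₁ : Γ₁.Includes 1) (h₁₀ : Γ₁.Excludes 0)
    (h₁w : ∀ s ∈ Set.Icc (0 : ℝ) 1, Γ₁.Excludes (Γ₀.path s)) :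
    (∀ (n : ℕ) (t : ℝ), ∃! Φ : Fin n → ℤ → ℂ,
      PushASEP.IsDualFamily C a b (fun _ => 1) (fun k => -(k : ℤ)) n t Φ) ∧
    ∀ Φ : (n : ℕ) → ℝ → Fin n → ℤ → ℂ,
      (∀ (n : ℕ) (t : ℝ),
        PushASEP.IsDualFamily C a b (fun _ => 1) (fun k => -(k : ℤ)) n t (Φ n t)) →
      ∀ (m : ℕ) (p : Fin m → ℕ × ℝ), PushASEP.IsSpaceLike p →
        (∀ (i j : Fin m) (x₁ x₂ : ℤ),
          PushASEP.stepKernel Γ Γ₀ Γ₁ a b (p i) x₁ (p j) x₂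
            = (-1 : ℂ) ^ (((p i).1 : ℤ) - ((p j).1 : ℤ))
              * PushASEP.kernel C a b (fun _ => 1) (fun k => -(k : ℤ)) Φ (p i) x₁ (p j) x₂) ∧
        (∀ (r : ℕ) (q : Fin r → Fin m × ℤ),
          (Matrix.of fun α β : Fin r =>
              PushASEP.stepKernel Γ Γ₀ Γ₁ a b (p (q α).1) (q α).2 (p (q β).1) (q β).2).det
            = (Matrix.of fun α β : Fin r =>
              PushASEP.kernel C a b (fun _ => 1) (fun k => -(k : ℤ)) Φ
                (p (q α).1) (q α).2 (p (q β).1) (q β).2).det) := by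
  have hexists := PushASEP.isDualFamily_stepDual hC0 hC1 h₁ h₁₀ a b
  refine ⟨fun n t => ⟨_, hexists n t, fun Φ hΦ => (hexists n t).unique hΦ⟩,
    fun Φ hΦ m p hp => ?_⟩
  -- Uniqueness identifies any admissible family with the explicit residues around `Γ₁`.
  obtain rfl : Φ = PushASEP.stepDual Γ₁ a b :=
    funext fun n => funext fun t => (hexists n t).unique (hΦ n t)
  have key := fun i j => PushASEP.stepKernel_eq_mul_kernel hC0 hC1 h₀ h₀₁ h₁ h₁₀ a b hΓ0 hΓ1
    h₁w (hp.prec_or_le i j)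
  refine ⟨key, fun r q => ?_⟩
  simp_rw [key]
  exact PushASEP.det_conj_neg_one (fun α => (p (q α).1).1) (Matrix.of fun α β =>
    PushASEP.kernel C a b (fun _ => 1) (fun k => -(k : ℤ)) (PushASEP.stepDual Γ₁ a b)
      (p (q α).1) (q α).2 (p (q β).1) (q β).2)
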